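/- Let $P$ be a left Ore semigroup, i.e. a (discrete) semigroup with unit which is cancellative and in which any two non-empty left ideals intersect, and let $G=P^{-1}P\supseteq P$ be its enveloping group (group of left quotients). For $p\in P$ let $V_p$ be the isometry $\varepsilon_x\mapsto\varepsilon_{px}$ of $\ell^2(P)$, and let $C^*_r(P)=C^*(\{V_p : p\in P\})\subseteq\mathcal L(\ell^2(P))$. Let $\mathcal J$ be the family of constructible right ideals of $P$, i.e. the smallest family of right ideals of $P$ which contains $\emptyset$ and $P$ and is closed under $X\mapsto pX$, $X\mapsto p^{-1}X=\{q\in P: pq\in X\}$ ($p\in P$) and finite intersections. Let $D_r(P)=C^*(\{E_X: X\in\mathcal J\})\subseteq\mathcal L(\ell^2(P))$, where $E_X$ is the orthogonal projection onto $\ell^2(X)$, and let $\tau_p=\mathrm{Ad}(V_p)|_{D_r(P)}$ for $p\in P$. Let $D_r^{(\infty)}(P)$ be the inductive limit of copies of $D_r(P)$ indexed by $p\in P$, directed by $p\le q:\Leftrightarrow q\in Pp$, with connecting maps $\tau_{qp^{-1}}$ from the $p$-th to the $q$-th copy; let $\iota_p$ be the inclusion of the $p$-th copy. We regard $D_r^{(\infty)}(P)$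 as a C*-algebra on $\ell^2(G)$ via the canonical faithful representation $\iota_p(d)\mapsto\lambda_p^*\,d\,\lambda_p$ ($d$ acting on $\ell^2(P)\subseteq\ell^2(G)$ and by $0$ on the orthogonal complement, $\lambda$ the left regular representation of $G$), and we let $G$ act on it by $\tau^{(\infty)}_g=\mathrm{Ad}(\lambda_g)$, so that $\tau^{(\infty)}_p(\iota_q(d))=\iota_{rp^{-1}}(\tau_{rq^{-1}}(d))$ for $p,q\le r$. Let $B=D_r^{(\infty)}(P)\rtimes_{\tau^{(\infty)},r}G$ be the reduced crossed product, with canonical unitaries $U_g$ ($g\in G$) in its multiplier algebra, and let $E_P\in D_r^{(\infty)}(P)\subseteq B$ be the orthogonal projection of $\ell^2(G)$ onto $\ell^2(P)$. Then: 1. $E_P$ is a full projection in $B$, i.e. $BE_PB$ spans a dense subspace of $B$. 2. There is an injective $*$-homomorphism $\iota: C^*_r(P)\to B$ with $\iota(V_p)=E_PU_pE_P$ for all $p\in P$, and its image is the corner $E_PBE_P$. In other words, $V_p\mapsto E_PU_pE_P$ extends to an isomorphism $C^*_r(P)\cong E_PBE_P$. 3. If $P$ is countable, then $C^*_r(P)$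 and $B$ are separable, and the class of $\iota$ in $KK(C^*_r(P),B)$ is a KK-equivalence, i.e. it is invertible with respect to the Kasparov product. -/

import Mathlib

open Function

universe u

noncomputable section

namespace OreDilation

/-- The Hilbert space `ℓ²(X, H) = H ⊗ ℓ²(X)`; for `H = ℂ` this is `ℓ²(X)`. -/
abbrev Ell2 (X H : Type*) [NormedAddCommGroup H] := lp (fun _ : X => H) 2

/-- The bounded operators on a Hilbert space. -/
abbrev Op (H : Type*) [NormedAddCommGroup H] [InnerProductSpace ℂ H] := H →L[ℂ] H

open scoped Classical in
/-- The basis vector `ε_x` of `ℓ²(X)`. -/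
def basisVec {X : Type*} (x : X) : Ell2 X ℂ :=
  lp.single (E := fun _ : X => ℂ) 2 x (1 : ℂ)

open scoped Classical in
/-- The isometry `ξ ↦ ξ ⊗ ε_x` of `H` into `ℓ²(X, H)`. -/
def singleIsometry {X : Type*} (H : Type*) [NormedAddCommGroup H] [InnerProductSpace ℂ H] (x : X) :
    H →ₗᵢ[ℂ] Ell2 X H where
  toFun a := lp.single (E := fun _ : X => H) 2 x a
  map_add' a b := lp.single_add (E := fun _ : X => H) 2 x a b
  map_smul' c a := lp.single_smul (E := fun _ : X => H) 2 x c a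
  norm_map' a := lp.norm_single (E := fun _ : X => H) (by norm_num) x a

theorem singleIsometry_def {X H : Type*} [NormedAddCommGroup H] [InnerProductSpace ℂ H]
    [d : DecidableEq X] (x : X) (a : H) :
    (singleIsometry H x a : Ell2 X H) = lp.single (E := fun _ : X => H) 2 x a := by
  rw [Subsingleton.elim d (fun a b => Classical.propDecidable (a = b))]
  rfl

theorem adjoint_apply {H K : Type*} [NormedAddCommGroup H] [InnerProductSpace ℂ H]
    [CompleteSpace H] [NormedAddCommGroup K] [InnerProductSpace ℂ K] [CompleteSpace K]
    (V : H →ₗᵢ[ℂ] K) (ξ : H) : V.toContinuousLinearMap.adjoint (V ξ) = ξ := by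
  refine ext_inner_right ℂ fun η => ?_
  rw [ContinuousLinearMap.adjoint_inner_left]
  exact V.inner_map_map ξ η

theorem singleIsometry_apply {X H : Type*} [NormedAddCommGroup H] [InnerProductSpace ℂ H]
    (x : X) (a : H) (y : X) [Decidable (y = x)] :
    (singleIsometry H x a : Ell2 X H) y = if y = x then a else 0 := by
  classical
  have : (singleIsometry H x a : Ell2 X H) = lp.single (E := fun _ : X => H) 2 x a := singleIsometry_def x a
  rw [this, lp.single_apply]
  by_cases h : y = x
  · subst h; simp
  · simp [h]

theorem inner_single {X H : Type*} [NormedAddCommGroup H] [InnerProductSpace ℂ H]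
    (x : X) (a : H) (ξ : Ell2 X H) :
    inner ℂ (singleIsometry H x a) ξ = inner ℂ a (ξ x) := by
  classical
  have : (singleIsometry H x a : Ell2 X H) = lp.single (E := fun _ : X => H) 2 x a := singleIsometry_def x a
  rw [this, lp.inner_single_left]

theorem op_ext {X H K : Type*} [NormedAddCommGroup H] [InnerProductSpace ℂ H]
    [NormedAddCommGroup K] [NormedSpace ℂ K] {S T : Ell2 X H →L[ℂ] K}
    (h : ∀ x a, S (singleIsometry H x a) = T (singleIsometry H x a)) : S = T := by
  classical
  refine lp.ext_continuousLinearMap (by norm_num) fun x => ?_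
  ext a
  have := h x a
  have e : (singleIsometry H x a : Ell2 X H) = lp.single (E := fun _ : X => H) 2 x a := singleIsometry_def x a
  rw [e] at this
  exact this

theorem orthogonalFamily_single {X Y : Type*} (H : Type*) [NormedAddCommGroup H]
    [InnerProductSpace ℂ H] (f : X → Y) (hf : Injective f) :
    OrthogonalFamily ℂ (fun _ : X => H) (fun x => singleIsometry H (f x)) := by
  classical
  intro x y hxy a b
  rw [inner_single, singleIsometry_apply, if_neg (fun h => hxy (hf h)), inner_zero_right]

/-- The isometry `ℓ²(X, H) → ℓ²(Y, H)`, `ξ ⊗ ε_x ↦ ξ ⊗ ε_{f x}`, of an injective map `f`. -/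
def shift {X Y : Type*} (H : Type*) [NormedAddCommGroup H] [InnerProductSpace ℂ H]
    [CompleteSpace H] (f : X → Y) (hf : Injective f) : Ell2 X H →ₗᵢ[ℂ] Ell2 Y H :=
  (orthogonalFamily_single H f hf).linearIsometry

theorem shift_single {X Y H : Type*} [NormedAddCommGroup H] [InnerProductSpace ℂ H]
    [CompleteSpace H] (f : X → Y) (hf : Injective f) (x : X) (a : H) :
    shift H f hf (singleIsometry H x a) = singleIsometry H (f x) a := by
  classical
  have e : (singleIsometry H x a : Ell2 X H) = lp.single (E := fun _ : X => H) 2 x a := singleIsometry_def x a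
  rw [e]
  exact (orthogonalFamily_single H f hf).linearIsometry_apply_single (i := x) a

theorem shift_comp {X Y Z H : Type*} [NormedAddCommGroup H] [InnerProductSpace ℂ H]
    [CompleteSpace H] (f : X → Y) (hf : Injective f) (g : Y → Z) (hg : Injective g)
    (k : X → Z) (hk : Injective k) (e : ∀ x, k x = g (f x)) :
    (shift H g hg).comp (shift H f hf) = shift H k hk := by
  have : ((shift H g hg).comp (shift H f hf)).toContinuousLinearMap =
      (shift H k hk).toContinuousLinearMap := by
    refine op_ext fun x a => ?_
    simp [shift_single, e]
  ext1 ξ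
  exact congr($this ξ)

/-- `T ↦ V T V*` for an isometry `V`. -/
def conjHom {H K : Type*} [NormedAddCommGroup H] [InnerProductSpace ℂ H] [CompleteSpace H]
    [NormedAddCommGroup K] [InnerProductSpace ℂ K] [CompleteSpace K] (V : H →ₗᵢ[ℂ] K) :
    Op H →⋆ₙₐ[ℂ] Op K where
  toFun T := V.toContinuousLinearMap ∘L T ∘L V.toContinuousLinearMap.adjoint
  map_smul' c T := by ext; simp
  map_zero' := by ext; simp
  map_add' S T := by ext; simp
  map_mul' S T := by
    ext ξ
    simp [adjoint_apply]
  map_star' T := by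
    simp [ContinuousLinearMap.star_eq_adjoint, ContinuousLinearMap.adjoint_comp,
      ContinuousLinearMap.comp_assoc]

theorem conjHom_comp {H K L : Type*} [NormedAddCommGroup H] [InnerProductSpace ℂ H]
    [CompleteSpace H] [NormedAddCommGroup K] [InnerProductSpace ℂ K] [CompleteSpace K]
    [NormedAddCommGroup L] [InnerProductSpace ℂ L] [CompleteSpace L]
    (W : K →ₗᵢ[ℂ] L) (V : H →ₗᵢ[ℂ] K) (T : Op H) :
    conjHom W (conjHom V T) = conjHom (W.comp V) T := by
  have : (W.comp V).toContinuousLinearMap =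
    W.toContinuousLinearMap ∘L V.toContinuousLinearMap := rfl
  simp [conjHom, this, ContinuousLinearMap.adjoint_comp, ContinuousLinearMap.comp_assoc]

theorem conjHom_injective {H K : Type*} [NormedAddCommGroup H] [InnerProductSpace ℂ H]
    [CompleteSpace H] [NormedAddCommGroup K] [InnerProductSpace ℂ K] [CompleteSpace K]
    (V : H →ₗᵢ[ℂ] K) : Injective (conjHom V) := by
  intro S T hST
  ext ξ
  have := congr($hST (V ξ))
  simpa [conjHom, adjoint_apply] using this

theorem conjHom_one {H : Type*} [NormedAddCommGroup H] [InnerProductSpace ℂ H]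
    [CompleteSpace H] (T : Op H) : conjHom LinearIsometry.id T = T := by
  have : (LinearIsometry.id : H →ₗᵢ[ℂ] H).toContinuousLinearMap = ContinuousLinearMap.id ℂ H := rfl
  have h2 := ContinuousLinearMap.adjoint_id (𝕜 := ℂ) (E := H)
  ext ξ
  simp [conjHom, this, h2]

theorem shift_id {X H : Type*} [NormedAddCommGroup H] [InnerProductSpace ℂ H]
    [CompleteSpace H] (f : X → X) (hf : Injective f) (e : ∀ x, f x = x) :
    shift H f hf = LinearIsometry.id := by
  have : (shift H f hf).toContinuousLinearMap =
      (LinearIsometry.id : Ell2 X H →ₗᵢ[ℂ] Ell2 X H).toContinuousLinearMap := by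
    refine op_ext fun x a => ?_
    simp [shift_single, e]
  ext1 ξ
  exact congr($this ξ)

/-- The orthogonal projection `E_Y` of `ℓ²(X)` onto the closed subspace `ℓ²(Y)` spanned by the
vectors `ε_y`, `y ∈ Y`. -/
def proj {X : Type*} (Y : Set X) : Op (Ell2 X ℂ) :=
  (Submodule.span ℂ (basisVec '' Y)).topologicalClosure.starProjection

theorem singleIsometry_eq {X : Type*} (x : X) (a : ℂ) :
    singleIsometry ℂ x a = a • basisVec x := by
  classical
  ext y
  rw [singleIsometry_apply, lp.coeFn_smul]
  simp only [basisVec, Pi.smul_apply]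
  rw [lp.single_apply]
  by_cases h : y = x
  · subst h; simp
  · simp [h]

theorem proj_single {X : Type*} (Y : Set X) (x : X) (a : ℂ) [Decidable (x ∈ Y)] :
    proj Y (singleIsometry ℂ x a) = if x ∈ Y then singleIsometry ℂ x a else 0 := by
  classical
  split_ifs with h
  · rw [proj, Submodule.starProjection_eq_self_iff]
    apply Submodule.le_topologicalClosure
    rw [singleIsometry_eq]
    exact Submodule.smul_mem _ _ (Submodule.subset_span ⟨x, h, rfl⟩)
  · rw [proj, Submodule.starProjection_apply_eq_zero_iff, Submodule.orthogonal_closure]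
    rw [Submodule.mem_orthogonal]
    intro u hu
    induction hu using Submodule.span_induction with
    | zero => simp
    | add u v _ _ hu hv => rw [inner_add_left, hu, hv, add_zero]
    | smul c u _ hu => rw [inner_smul_left, hu, mul_zero]
    | mem u hu =>
    obtain ⟨y, hy, rfl⟩ := hu
    have : basisVec y = singleIsometry ℂ y (1 : ℂ) := by rw [singleIsometry_eq, one_smul]
    rw [this, inner_single, singleIsometry_apply, if_neg (by rintro rfl; exact h hy)]
    simp

theorem conj_shift_proj {X Z : Type*} (f : X → Z) (hf : Injective f) (Y : Set X) :
    conjHom (shift ℂ f hf) (proj Y) = proj (f '' Y) := by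
  classical
  refine op_ext fun z a => ?_
  rw [proj_single]
  by_cases hz : ∃ x, f x = z
  · obtain ⟨x, rfl⟩ := hz
    have h' := adjoint_apply (shift ℂ f hf) (singleIsometry ℂ x a)
    rw [shift_single] at h'
    simp only [conjHom, NonUnitalStarAlgHom.coe_mk]
    simp [h', proj_single, hf.eq_iff]
    split_ifs <;> simp [shift_single]
  · have h0 : (shift ℂ f hf).toContinuousLinearMap.adjoint (singleIsometry ℂ z a) = 0 := by
      refine ext_inner_right ℂ fun ξ => ?_
      rw [ContinuousLinearMap.adjoint_inner_left, inner_single, inner_zero_left]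
      have : (lp.evalCLM ℂ (fun _ : Z => ℂ) 2 z) ∘L (shift ℂ f hf).toContinuousLinearMap = 0 := by
        refine op_ext fun x b => ?_
        simp [shift_single]
        change (singleIsometry ℂ (f x) b : Ell2 Z ℂ) z = 0
        rw [singleIsometry_apply, if_neg (fun h => hz ⟨x, h.symm⟩)]
      have := congr($this ξ)
      have h2 : ((shift ℂ f hf).toContinuousLinearMap ξ : Ell2 Z ℂ) z = 0 := this
      rw [h2, inner_zero_right]
    rw [if_neg (by rintro ⟨x, -, rfl⟩; exact hz ⟨x, rfl⟩)]
    simp [conjHom, h0]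

/- Semigroups, constructible right ideals, enveloping groups. -/

/-- `X` is a left ideal of the semigroup `P`. -/
def IsLeftIdeal {P : Type*} [Monoid P] (X : Set P) : Prop :=
  ∀ x ∈ X, ∀ p : P, p * x ∈ X

/-- The left Ore condition: `P` is cancellative and right reversible, that is, any two non-empty
left ideals intersect. -/
class IsLeftOre (P : Type*) [Monoid P] : Prop extends IsCancelMul P where
  rightReversible : ∀ X Y : Set P, IsLeftIdeal X → IsLeftIdeal Y → X.Nonempty → Y.Nonempty →
    (X ∩ Y).Nonempty

/-- The constructible right ideals of `P`: the smallest family of subsets (all of which are right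
ideals) containing `∅` and `P` and closed under left multiplication, preimages under left
multiplication and finite intersections. -/
inductive IsConstructible {P : Type*} [Monoid P] : Set P → Prop
  | empty : IsConstructible ∅
  | univ : IsConstructible Set.univ
  | image (p : P) {X : Set P} : IsConstructible X → IsConstructible ((fun x => p * x) '' X)
  | preimage (p : P) {X : Set P} : IsConstructible X → IsConstructible ((fun x => p * x) ⁻¹' X)
  | inter {X Y : Set P} : IsConstructible X → IsConstructible Y → IsConstructible (X ∩ Y)

/-- `G` is an enveloping group of `P` via `i`: `i` embeds `P` into `G`, and `G = P⁻¹ P`. -/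
structure IsEnvelopingGroup {P G : Type*} [Monoid P] [Group G] (i : P →* G) : Prop where
  injective : Injective i
  exists_quotient : ∀ g : G, ∃ q p : P, g = (i q)⁻¹ * i p

/-- The C*-subalgebra `C*(S)` generated by a subset `S` of a C*-algebra. -/
def cstarGen {A : Type*} [NonUnitalCStarAlgebra A] (S : Set A) : NonUnitalStarSubalgebra ℂ A :=
  (NonUnitalStarAlgebra.adjoin ℂ S).topologicalClosure

instance {A : Type*} [NonUnitalCStarAlgebra A] (S : Set A) :
    IsClosed (cstarGen S : Set A) :=
  NonUnitalStarSubalgebra.isClosed_topologicalClosure _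

theorem subset_cstarGen {A : Type*} [NonUnitalCStarAlgebra A] (S : Set A) :
    S ⊆ (cstarGen S : Set A) := fun _ h =>
  NonUnitalStarSubalgebra.le_topologicalClosure _ (NonUnitalStarAlgebra.subset_adjoin ℂ S h)

theorem cstarGen_le {A : Type*} [NonUnitalCStarAlgebra A] {S : Set A}
    {T : NonUnitalStarSubalgebra ℂ A} (hT : IsClosed (T : Set A)) (h : S ⊆ (T : Set A)) :
    cstarGen S ≤ T :=
  NonUnitalStarSubalgebra.topologicalClosure_minimal _ (NonUnitalStarAlgebra.adjoin_le h) hT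

theorem map_mem_of_gen {A B : Type*} [NonUnitalCStarAlgebra A] [NonUnitalCStarAlgebra B]
    (φ : A →⋆ₙₐ[ℂ] B) (hφ : Continuous φ) {S : Set A} {T : NonUnitalStarSubalgebra ℂ B}
    (hT : IsClosed (T : Set B)) (h : ∀ s ∈ S, φ s ∈ T) {a : A} (ha : a ∈ cstarGen S) : φ a ∈ T :=
  cstarGen_le (T := T.comap φ) (hT.preimage hφ) h ha

/-- The isometry `V_p` on `ℓ²(P)`, `ε_x ↦ ε_{px}`. -/
def leftIsometry {P : Type*} [Monoid P] [IsLeftCancelMul P] (p : P) : Ell2 P ℂ →ₗᵢ[ℂ] Ell2 P ℂ :=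
  shift ℂ (fun x => p * x) (mul_right_injective p)

/-- The operator `V_p` on `ℓ²(P)`. -/
def V {P : Type*} [Monoid P] [IsLeftCancelMul P] (p : P) : Op (Ell2 P ℂ) :=
  (leftIsometry p).toContinuousLinearMap

/-- The reduced semigroup C*-algebra `C*_r(P)`. -/
def CStarReduced (P : Type*) [Monoid P] [IsLeftCancelMul P] :
    NonUnitalStarSubalgebra ℂ (Op (Ell2 P ℂ)) :=
  cstarGen (Set.range V)

instance (P : Type*) [Monoid P] [IsLeftCancelMul P] :
    IsClosed (CStarReduced P : Set (Op (Ell2 P ℂ))) :=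
  NonUnitalStarSubalgebra.isClosed_topologicalClosure _

instance (P : Type*) [Monoid P] [IsLeftCancelMul P] : NonUnitalCStarAlgebra (CStarReduced P) :=
  NonUnitalStarSubalgebra.nonUnitalCStarAlgebra _

/-- `V_p` as an element of `C*_r(P)`. -/
def genV {P : Type*} [Monoid P] [IsLeftCancelMul P] (p : P) : CStarReduced P :=
  ⟨V p, subset_cstarGen _ ⟨p, rfl⟩⟩

/-- The commutative C*-algebra `D_r(P)` generated by the projections `E_X`, for `X` a constructible
right ideal. -/
def diagonalAlgebra (P : Type*) [Monoid P] : NonUnitalStarSubalgebra ℂ (Op (Ell2 P ℂ)) :=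
  cstarGen {T | ∃ X : Set P, IsConstructible X ∧ T = proj X}

instance (P : Type*) [Monoid P] :
    IsClosed (diagonalAlgebra P : Set (Op (Ell2 P ℂ))) :=
  NonUnitalStarSubalgebra.isClosed_topologicalClosure _

theorem continuous_conjHom {H K : Type*} [NormedAddCommGroup H] [InnerProductSpace ℂ H]
    [CompleteSpace H] [NormedAddCommGroup K] [InnerProductSpace ℂ K] [CompleteSpace K]
    (V : H →ₗᵢ[ℂ] K) : Continuous (conjHom V) :=
  (NonUnitalStarAlgHom.isometry (conjHom V) (conjHom_injective V)).continuous

theorem conj_mem_diagonal {P : Type*} [Monoid P] [IsLeftCancelMul P] (p : P)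
    {T : Op (Ell2 P ℂ)} (hT : T ∈ diagonalAlgebra P) :
    conjHom (leftIsometry p) T ∈ diagonalAlgebra P := by
  refine map_mem_of_gen (conjHom (leftIsometry p)) (continuous_conjHom _)
    (S := {T | ∃ X : Set P, IsConstructible X ∧ T = proj X}) (T := diagonalAlgebra P)
    (NonUnitalStarSubalgebra.isClosed_topologicalClosure _) ?_ hT
  rintro _ ⟨X, hX, rfl⟩
  rw [leftIsometry, conj_shift_proj]
  exact subset_cstarGen _ ⟨_, hX.image p, rfl⟩

/-- The endomorphism `τ_p = Ad(V_p)` of `D_r(P)`. -/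
def tau {P : Type*} [Monoid P] [IsLeftCancelMul P] (p : P) :
    diagonalAlgebra P →⋆ₙₐ[ℂ] diagonalAlgebra P :=
  NonUnitalStarAlgHom.codRestrict
    ((conjHom (leftIsometry p)).comp (NonUnitalStarSubalgebraClass.subtype (diagonalAlgebra P)))
    _ fun d => conj_mem_diagonal p d.2

/- The dilation of `(D_r(P), τ)` to an action of the enveloping group. -/

/-- The left regular representation `λ_g` of a group on `ℓ²(G)`. -/
def lam {G : Type*} [Group G] (g : G) : Ell2 G ℂ →ₗᵢ[ℂ] Ell2 G ℂ :=
  shift ℂ (fun x => g * x) (mul_right_injective g)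

/-- The canonical embedding `ℓ²(P) → ℓ²(G)`. -/
def embed {P G : Type*} [Monoid P] [Group G] {i : P →* G} (hi : IsEnvelopingGroup i) :
    Ell2 P ℂ →ₗᵢ[ℂ] Ell2 G ℂ :=
  shift ℂ i hi.injective

/-- The representation `π_p = Ad(λ_p*) ∘ π` on `ℓ²(G)` of the operators on `ℓ²(P)`, where `π` is
conjugation by the embedding `ℓ²(P) → ℓ²(G)`. -/
def piRep {P G : Type*} [Monoid P] [Group G] {i : P →* G} (hi : IsEnvelopingGroup i) (p : P) :
    Op (Ell2 P ℂ) →⋆ₙₐ[ℂ] Op (Ell2 G ℂ) :=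
  (conjHom (lam (i p)⁻¹)).comp (conjHom (embed hi))

/-- The dilated algebra `D_r^{(∞)}(P)`: the inductive limit, over `P` directed by
`p ≤ q ↔ q ∈ P p`, of copies of `D_r(P)` with the connecting maps `τ_{q p⁻¹}`, in its canonical
faithful representation on `ℓ²(G)`, which is `π_p` on the `p`-th copy.
See `limitIncl_comp_tau`, `limitIncl_injective` and `dense_iUnion_range_limitIncl`. -/
def dilatedAlgebra {P G : Type*} [Monoid P] [Group G] {i : P →* G} (hi : IsEnvelopingGroup i) :
    NonUnitalStarSubalgebra ℂ (Op (Ell2 G ℂ)) :=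
  cstarGen (⋃ p : P, piRep hi p '' (diagonalAlgebra P : Set (Op (Ell2 P ℂ))))

instance {P G : Type*} [Monoid P] [Group G] {i : P →* G} (hi : IsEnvelopingGroup i) :
    IsClosed (dilatedAlgebra hi : Set (Op (Ell2 G ℂ))) :=
  NonUnitalStarSubalgebra.isClosed_topologicalClosure _

/-- The inclusion `ι_p` of the `p`-th copy of `D_r(P)` into `D_r^{(∞)}(P)`. -/
def limitIncl {P G : Type*} [Monoid P] [Group G] {i : P →* G} (hi : IsEnvelopingGroup i) (p : P) :
    diagonalAlgebra P →⋆ₙₐ[ℂ] dilatedAlgebra hi :=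
  NonUnitalStarAlgHom.codRestrict
    ((piRep hi p).comp (NonUnitalStarSubalgebraClass.subtype (diagonalAlgebra P)))
    _ fun d => subset_cstarGen _ (Set.mem_iUnion.2 ⟨p, d, d.2, rfl⟩)

theorem piRep_eq {P G : Type*} [Monoid P] [Group G] {i : P →* G} (hi : IsEnvelopingGroup i)
    (p : P) (T : Op (Ell2 P ℂ)) :
    piRep hi p T = conjHom (shift ℂ (fun x => (i p)⁻¹ * i x)
      ((mul_right_injective _).comp hi.injective)) T := by
  change conjHom _ (conjHom _ T) = _
  rw [conjHom_comp, lam, embed, shift_comp]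
  exact fun _ => rfl

theorem conj_lam_piRep {P G : Type*} [Monoid P] [IsLeftCancelMul P] [Group G] {i : P →* G}
    (hi : IsEnvelopingGroup i) {g : G} {q a b : P} (h : g * (i q)⁻¹ = (i a)⁻¹ * i b)
    (T : Op (Ell2 P ℂ)) :
    conjHom (lam g) (piRep hi q T) = piRep hi a (conjHom (leftIsometry b) T) := by
  have inj : Injective (fun x => (i a)⁻¹ * i (b * x)) :=
    (mul_right_injective _).comp (hi.injective.comp (mul_right_injective b))
  rw [piRep_eq, piRep_eq, conjHom_comp, conjHom_comp, lam, leftIsometry,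
    shift_comp _ _ _ _ (fun x => (i a)⁻¹ * i (b * x)) inj,
    shift_comp _ _ _ _ (fun x => (i a)⁻¹ * i (b * x)) inj]
  · exact fun _ => rfl
  · intro x
    rw [map_mul, ← mul_assoc, ← h, mul_assoc]

theorem lam_one {G : Type*} [Group G] : lam (1 : G) = LinearIsometry.id :=
  shift_id _ _ (by simp)

theorem lam_comp {G : Type*} [Group G] (g h : G) : (lam g).comp (lam h) = lam (g * h) :=
  shift_comp _ _ _ _ _ _ (by simp [mul_assoc])

/-- Compatibility of the inclusions with the connecting map `τ_r` from the `p`-th to the `rp`-th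
copy. -/
theorem limitIncl_comp_tau {P G : Type*} [Monoid P] [IsLeftCancelMul P] [Group G] {i : P →* G}
    (hi : IsEnvelopingGroup i) (r p : P) (d : diagonalAlgebra P) :
    limitIncl hi (r * p) (tau r d) = limitIncl hi p d := by
  refine Subtype.ext ?_
  change piRep hi (r * p) (conjHom (leftIsometry r) d) = piRep hi p d
  rw [← conj_lam_piRep hi (g := 1) (q := p) (by simp), lam_one, conjHom_one]

theorem limitIncl_injective {P G : Type*} [Monoid P] [Group G] {i : P →* G}
    (hi : IsEnvelopingGroup i) (p : P) : Injective (limitIncl hi p) := by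
  intro x y h
  have h' : piRep hi p x = piRep hi p y := congrArg Subtype.val h
  rw [piRep_eq, piRep_eq] at h'
  exact Subtype.ext (conjHom_injective _ h')

theorem exists_common {P G : Type*} [Monoid P] [Group G] {i : P →* G}
    (hi : IsEnvelopingGroup i) (p q : P) : ∃ a b : P, a * p = b * q := by
  obtain ⟨a, b, h⟩ := hi.exists_quotient (i p * (i q)⁻¹)
  refine ⟨a, b, hi.injective ?_⟩
  rw [map_mul, map_mul]
  calc i a * i p = i a * (i p * (i q)⁻¹) * i q := by group
    _ = i b * i q := by rw [h]; group

/-- The union of the copies of `D_r(P)` is dense in `D_r^{(∞)}(P)`. -/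
theorem dense_iUnion_range_limitIncl {P G : Type*} [Monoid P] [IsLeftCancelMul P] [Group G]
    {i : P →* G} (hi : IsEnvelopingGroup i) : Dense (⋃ p : P, Set.range (limitIncl hi p)) := by
  have dir : ∀ (p q : P) (d e : diagonalAlgebra P), ∃ (r : P) (d' e' : diagonalAlgebra P),
      piRep hi p d = piRep hi r d' ∧ piRep hi q e = piRep hi r e' := by
    intro p q d e
    obtain ⟨a, b, h⟩ := exists_common hi p q
    refine ⟨a * p, tau a d, tau b e, ?_, ?_⟩
    · exact (congrArg Subtype.val (limitIncl_comp_tau hi a p d)).symm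
    · rw [h]
      exact (congrArg Subtype.val (limitIncl_comp_tau hi b q e)).symm
  let U : NonUnitalStarSubalgebra ℂ (Op (Ell2 G ℂ)) :=
    { carrier := {T | ∃ (p : P) (d : diagonalAlgebra P), T = piRep hi p d}
      add_mem' := by
        rintro _ _ ⟨p, d, rfl⟩ ⟨q, e, rfl⟩
        obtain ⟨r, d', e', h1, h2⟩ := dir p q d e
        exact ⟨r, d' + e', by rw [h1, h2]; simp⟩
      zero_mem' := ⟨1, 0, by simp⟩
      mul_mem' := by
        rintro _ _ ⟨p, d, rfl⟩ ⟨q, e, rfl⟩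
        obtain ⟨r, d', e', h1, h2⟩ := dir p q d e
        exact ⟨r, d' * e', by rw [h1, h2]; simp⟩
      smul_mem' := by
        rintro c _ ⟨p, d, rfl⟩
        exact ⟨p, ⟨c • (d : Op (Ell2 P ℂ)), SMulMemClass.smul_mem c d.2⟩, (map_smul (piRep hi p) c _).symm⟩
      star_mem' := by
        rintro _ ⟨p, d, rfl⟩
        exact ⟨p, star d, by rw [← map_star]; rfl⟩ }
  have hU : dilatedAlgebra hi ≤ U.topologicalClosure := by
    refine cstarGen_le (NonUnitalStarSubalgebra.isClosed_topologicalClosure _) ?_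
    intro T hT
    obtain ⟨p, d, hd, rfl⟩ := Set.mem_iUnion.1 hT
    exact NonUnitalStarSubalgebra.le_topologicalClosure _ ⟨p, ⟨d, hd⟩, rfl⟩
  intro x
  rw [closure_subtype]
  have := hU x.2
  refine closure_mono ?_ this
  rintro _ ⟨p, d, rfl⟩
  exact ⟨limitIncl hi p d, Set.mem_iUnion.2 ⟨p, d, rfl⟩, rfl⟩

theorem conj_lam_mem {P G : Type*} [Monoid P] [IsLeftCancelMul P] [Group G] {i : P →* G}
    (hi : IsEnvelopingGroup i) (g : G) {T : Op (Ell2 G ℂ)} (hT : T ∈ dilatedAlgebra hi) :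
    conjHom (lam g) T ∈ dilatedAlgebra hi := by
  refine map_mem_of_gen (conjHom (lam g)) (continuous_conjHom _)
    (S := ⋃ p : P, piRep hi p '' (diagonalAlgebra P : Set (Op (Ell2 P ℂ))))
    (T := dilatedAlgebra hi) (NonUnitalStarSubalgebra.isClosed_topologicalClosure _) ?_ hT
  intro S hS
  obtain ⟨q, d, hd, rfl⟩ := Set.mem_iUnion.1 hS
  obtain ⟨a, b, h⟩ := hi.exists_quotient (g * (i q)⁻¹)
  rw [conj_lam_piRep hi h]
  exact subset_cstarGen _ (Set.mem_iUnion.2 ⟨a, _, conj_mem_diagonal b hd, rfl⟩)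

/-- `Ad(λ_g)` as an endomorphism of `D_r^{(∞)}(P)`. -/
def dilatedHom {P G : Type*} [Monoid P] [IsLeftCancelMul P] [Group G] {i : P →* G}
    (hi : IsEnvelopingGroup i) (g : G) : dilatedAlgebra hi →⋆ₙₐ[ℂ] dilatedAlgebra hi :=
  NonUnitalStarAlgHom.codRestrict
    ((conjHom (lam g)).comp (NonUnitalStarSubalgebraClass.subtype (dilatedAlgebra hi)))
    _ fun d => conj_lam_mem hi g d.2

theorem dilatedHom_comp {P G : Type*} [Monoid P] [IsLeftCancelMul P] [Group G] {i : P →* G}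
    (hi : IsEnvelopingGroup i) (g h : G) (d : dilatedAlgebra hi) :
    dilatedHom hi g (dilatedHom hi h d) = dilatedHom hi (g * h) d := by
  refine Subtype.ext ?_
  change conjHom (lam g) (conjHom (lam h) d) = conjHom (lam (g * h)) d
  rw [conjHom_comp, lam_comp]

theorem dilatedHom_one {P G : Type*} [Monoid P] [IsLeftCancelMul P] [Group G] {i : P →* G}
    (hi : IsEnvelopingGroup i) (d : dilatedAlgebra hi) : dilatedHom hi 1 d = d := by
  refine Subtype.ext ?_
  change conjHom (lam (1 : G)) d = d
  rw [lam_one, conjHom_one]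

/-- The dilated action `τ^{(∞)}` of `G` on `D_r^{(∞)}(P)`; see `dilatedAction_limitIncl`. -/
def dilatedAction {P G : Type*} [Monoid P] [IsLeftCancelMul P] [Group G] {i : P →* G}
    (hi : IsEnvelopingGroup i) : G →* (dilatedAlgebra hi ≃⋆ₐ[ℂ] dilatedAlgebra hi) where
  toFun g := StarAlgEquiv.ofNonUnitalStarAlgHom (dilatedHom hi g) (dilatedHom hi g⁻¹)
    (by ext1 d; simp [dilatedHom_comp, dilatedHom_one])
    (by ext1 d; simp [dilatedHom_comp, dilatedHom_one])
  map_one' := by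
    ext1 d
    exact dilatedHom_one hi d
  map_mul' g h := by
    ext1 d
    exact (dilatedHom_comp hi g h d).symm

/-- The formula `τ^{(∞)}_p (ι_q (d)) = ι_{r p⁻¹} (τ_{r q⁻¹} (d))` for `r ≥ p, q`, where
`r = a p = b q`. -/
theorem dilatedAction_limitIncl {P G : Type*} [Monoid P] [IsLeftCancelMul P] [Group G] {i : P →* G}
    (hi : IsEnvelopingGroup i) (p q a b : P) (h : a * p = b * q) (d : diagonalAlgebra P) :
    dilatedAction hi (i p) (limitIncl hi q d) = limitIncl hi a (tau b d) := by
  refine Subtype.ext ?_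
  refine conj_lam_piRep hi ?_ d
  have h' : i a * i p = i b * i q := by rw [← map_mul, h, map_mul]
  calc i p * (i q)⁻¹ = (i a)⁻¹ * (i a * i p) * (i q)⁻¹ := by group
    _ = (i a)⁻¹ * i b := by rw [h']; group

/-- The projection `E_P` of `ℓ²(G)` onto `ℓ²(P)`, as an element of `D_r^{(∞)}(P)`. -/
def projP {P G : Type*} [Monoid P] [Group G] {i : P →* G} (hi : IsEnvelopingGroup i) :
    dilatedAlgebra hi :=
  ⟨proj (Set.range i), by
    have h := subset_cstarGen _ (Set.mem_iUnion.2
      ⟨(1 : P), proj Set.univ, subset_cstarGen _ ⟨Set.univ, IsConstructible.univ, rfl⟩, rfl⟩ :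
        piRep hi 1 (proj Set.univ) ∈
          ⋃ p : P, piRep hi p '' (diagonalAlgebra P : Set (Op (Ell2 P ℂ))))
    rw [piRep_eq, conj_shift_proj] at h
    have e : (fun x => (i 1)⁻¹ * i x) '' Set.univ = Set.range i := by simp
    rw [e] at h
    exact h⟩

/- Reduced crossed products by discrete groups. -/

/-- The operator `ι_A(a)` on `ℓ²(G, H) = H ⊗ ℓ²(G)`, `ι_A(a)(ξ ⊗ ε_g) = ρ(α_{g⁻¹}(a)) ξ ⊗ ε_g`. -/
def crossedCoeff {G A H : Type*} [Group G] [NonUnitalCStarAlgebra A] [NormedAddCommGroup H]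
    [InnerProductSpace ℂ H] [CompleteSpace H] (α : G →* (A ≃⋆ₐ[ℂ] A)) (ρ : A →⋆ₙₐ[ℂ] Op H)
    (a : A) : Op (Ell2 G H) :=
  lp.mapCLM 2 (fun g => ρ (α g⁻¹ a)) (norm_nonneg a) fun g =>
    (NonUnitalStarAlgHom.norm_apply_le ρ _).trans
      (NonUnitalStarAlgHom.norm_apply_le (α g⁻¹ : A →⋆ₙₐ[ℂ] A) a)

/-- The unitary `ι_G(g) = 1 ⊗ λ_g` on `ℓ²(G, H) = H ⊗ ℓ²(G)`. -/
def crossedUnitary {G : Type*} (H : Type*) [Group G] [NormedAddCommGroup H]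
    [InnerProductSpace ℂ H] [CompleteSpace H] (g : G) : Op (Ell2 G H) :=
  (shift H (fun x => g * x) (mul_right_injective g)).toContinuousLinearMap

/-- The reduced crossed product `A ⋊_{α,r} G` of a C*-dynamical system with `G` discrete, with `A`
represented faithfully on `H` by `ρ`: the C*-algebra on `H ⊗ ℓ²(G)` generated by the operators
`ι_A(a) ι_G(g)`. -/
def reducedCrossedProduct {G A H : Type*} [Group G] [NonUnitalCStarAlgebra A] [NormedAddCommGroup H]
    [InnerProductSpace ℂ H] [CompleteSpace H] (α : G →* (A ≃⋆ₐ[ℂ] A)) (ρ : A →⋆ₙₐ[ℂ] Op H)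
    (_hρ : Injective ρ) : NonUnitalStarSubalgebra ℂ (Op (Ell2 G H)) :=
  cstarGen {T | ∃ (a : A) (g : G), T = crossedCoeff α ρ a * crossedUnitary H g}

instance {G A H : Type*} [Group G] [NonUnitalCStarAlgebra A] [NormedAddCommGroup H]
    [InnerProductSpace ℂ H] [CompleteSpace H] (α : G →* (A ≃⋆ₐ[ℂ] A)) (ρ : A →⋆ₙₐ[ℂ] Op H)
    (hρ : Injective ρ) : IsClosed (reducedCrossedProduct α ρ hρ : Set (Op (Ell2 G H))) :=
  NonUnitalStarSubalgebra.isClosed_topologicalClosure _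

theorem crossedUnitary_one {G : Type*} (H : Type*) [Group G] [NormedAddCommGroup H]
    [InnerProductSpace ℂ H] [CompleteSpace H] : crossedUnitary H (1 : G) = 1 := by
  rw [crossedUnitary, shift_id _ _ (by simp)]
  rfl

/-- `ι_A(a)` as an element of `A ⋊_{α,r} G`. -/
def crossedIncl {G A H : Type*} [Group G] [NonUnitalCStarAlgebra A] [NormedAddCommGroup H]
    [InnerProductSpace ℂ H] [CompleteSpace H] (α : G →* (A ≃⋆ₐ[ℂ] A)) (ρ : A →⋆ₙₐ[ℂ] Op H)
    (hρ : Injective ρ) (a : A) : reducedCrossedProduct α ρ hρ :=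
  ⟨crossedCoeff α ρ a, subset_cstarGen _ ⟨a, 1, by rw [crossedUnitary_one, mul_one]⟩⟩

/-- The reduced crossed product `D_r^{(∞)}(P) ⋊_{τ^{(∞)},r} G`. -/
def dilatedCrossed {P G : Type*} [Monoid P] [IsLeftCancelMul P] [Group G] {i : P →* G}
    (hi : IsEnvelopingGroup i) : NonUnitalStarSubalgebra ℂ (Op (Ell2 G (Ell2 G ℂ))) :=
  reducedCrossedProduct (dilatedAction hi)
    (NonUnitalStarSubalgebraClass.subtype (dilatedAlgebra hi)) Subtype.val_injective

instance {P G : Type*} [Monoid P] [IsLeftCancelMul P] [Group G] {i : P →* G}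
    (hi : IsEnvelopingGroup i) : IsClosed (dilatedCrossed hi : Set (Op (Ell2 G (Ell2 G ℂ)))) :=
  NonUnitalStarSubalgebra.isClosed_topologicalClosure _

instance {P G : Type*} [Monoid P] [IsLeftCancelMul P] [Group G] {i : P →* G}
    (hi : IsEnvelopingGroup i) : NonUnitalCStarAlgebra (dilatedCrossed hi) :=
  NonUnitalStarSubalgebra.nonUnitalCStarAlgebra _

/-- The projection `E_P` in `D_r^{(∞)}(P) ⋊_{τ^{(∞)},r} G`. -/
def crossedProjP {P G : Type*} [Monoid P] [IsLeftCancelMul P] [Group G] {i : P →* G}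
    (hi : IsEnvelopingGroup i) : dilatedCrossed hi :=
  crossedIncl (dilatedAction hi) _ _ (projP hi)

/- Full projections and corners. -/

/-- A projection `e` in a C*-algebra `B` is full if `B e B` spans a dense subspace of `B`. -/
structure IsFullProjection {B : Type*} [NonUnitalCStarAlgebra B] (e : B) : Prop where
  isStarProjection : IsStarProjection e
  full : Dense (Submodule.span ℂ {x : B | ∃ b c : B, x = b * e * c} : Set B)

/-- The corner `e B e`. -/
def corner {B : Type*} [NonUnitalCStarAlgebra B] (e : B) : Set B :=
  {x | ∃ b : B, x = e * b * e}

/- Hilbert C*-modules. -/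

/-- A (right) Hilbert `B`-module structure on the Banach space `E`: a right action `x · b` of `B` and
a `B`-valued inner product, conjugate-linear in the first variable, such that
`‖x‖² = ‖⟨x, x⟩‖`. The remaining module laws, such as the bilinearity and associativity of the
action, follow from the ones listed, because `⟨z, x⟩ = 0` for all `z` forces `x = 0`. (Mathlib's
`CStarModule` is `B`-linear on the left and needs a chosen order on `B`.) -/
class HilbertModule (B E : Type*) [NonUnitalCStarAlgebra B] [NormedAddCommGroup E]
    [NormedSpace ℂ E] where
  act : E → B → E
  ip : E → E → B
  ip_add : ∀ x y z : E, ip x (y + z) = ip x y + ip x z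
  ip_smul : ∀ (c : ℂ) (x y : E), ip x (c • y) = c • ip x y
  ip_act : ∀ (x y : E) (b : B), ip x (act y b) = ip x y * b
  star_ip : ∀ x y : E, star (ip x y) = ip y x
  ip_self : ∀ x : E, ∃ b : B, ip x x = star b * b
  norm_sq : ∀ x : E, ‖x‖ ^ 2 = ‖ip x x‖

/-- A C*-algebra as a Hilbert module over itself, `⟨x, y⟩ = x* y`. -/
instance HilbertModule.self (B : Type*) [NonUnitalCStarAlgebra B] : HilbertModule B B where
  act x b := x * b
  ip x y := star x * y
  ip_add x y z := mul_add _ _ _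
  ip_smul c x y := mul_smul_comm _ _ _
  ip_act x y b := (mul_assoc _ _ _).symm
  star_ip x y := by simp
  ip_self x := ⟨x, rfl⟩
  norm_sq x := by rw [CStarRing.norm_star_mul_self, sq]

/-- `E` is countably generated: for some countable set `s`, the elements `x · b` with `x ∈ s` span a
dense subspace. -/
def CountablyGenerated (B E : Type*) [NonUnitalCStarAlgebra B] [NormedAddCommGroup E]
    [NormedSpace ℂ E] [HilbertModule B E] : Prop :=
  ∃ s : Set E, s.Countable ∧
    Dense (Submodule.span ℂ {z : E | ∃ x ∈ s, ∃ b : B, z = HilbertModule.act x b} : Set E)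

/-- `S` is the adjoint of `T`, for operators between Hilbert `B`-modules. -/
def IsAdjoint (B : Type*) {E F : Type*} [NonUnitalCStarAlgebra B] [NormedAddCommGroup E]
    [NormedSpace ℂ E] [HilbertModule B E] [NormedAddCommGroup F] [NormedSpace ℂ F]
    [HilbertModule B F] (T : E →L[ℂ] F) (S : F →L[ℂ] E) : Prop :=
  ∀ (x : E) (y : F), (HilbertModule.ip (T x) y : B) = HilbertModule.ip x (S y)

/-- The compact operators `K(E, F)` between Hilbert `B`-modules: the closed linear span of the
operators `z ↦ x · ⟨y, z⟩`. -/
def compacts (B E F : Type*) [NonUnitalCStarAlgebra B] [NormedAddCommGroup E]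
    [NormedSpace ℂ E] [HilbertModule B E] [NormedAddCommGroup F] [NormedSpace ℂ F]
    [HilbertModule B F] : Submodule ℂ (E →L[ℂ] F) :=
  (Submodule.span ℂ {T : E →L[ℂ] F | ∃ (x : F) (y : E), ∀ z : E,
    T z = HilbertModule.act x (HilbertModule.ip y z : B)}).topologicalClosure

/- Kasparov modules. -/

/-- A Kasparov `(A, B)`-module for (trivially graded) C*-algebras `A`, `B`: a countably generated
Hilbert `B`-module `E` with a grading operator `γ`, a *-homomorphism `φ` from `A` to the
adjointable operators of degree `0`, and an adjointable operator `F` of degree `1` such that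
`[F, φ(a)]`, `(F² - 1) φ(a)` and `(F - F*) φ(a)` are compact for all `a`. -/
structure KasparovModule (A B : Type u) [NonUnitalCStarAlgebra A] [NonUnitalCStarAlgebra B] where
  E : Type u
  [normedAddCommGroup : NormedAddCommGroup E]
  [normedSpace : NormedSpace ℂ E]
  [completeSpace : CompleteSpace E]
  [hilbertModule : HilbertModule B E]
  countablyGenerated : CountablyGenerated B E
  γ : E →L[ℂ] E
  γ_sq : γ * γ = 1
  γ_ip : ∀ x y : E, (HilbertModule.ip (γ x) (γ y) : B) = HilbertModule.ip x y
  φ : A →ₙₐ[ℂ] (E →L[ℂ] E)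
  φ_star : ∀ a : A, IsAdjoint B (φ a) (φ (star a))
  φ_even : ∀ a : A, γ * φ a = φ a * γ
  F : E →L[ℂ] E
  Fstar : E →L[ℂ] E
  F_adjoint : IsAdjoint B F Fstar
  F_odd : γ * F = -(F * γ)
  commutator_compact : ∀ a : A, F * φ a - φ a * F ∈ compacts B E E
  sq_compact : ∀ a : A, (F * F - 1) * φ a ∈ compacts B E E
  selfAdjoint_compact : ∀ a : A, (F - Fstar) * φ a ∈ compacts B E E

attribute [instance] KasparovModule.normedAddCommGroup KasparovModule.normedSpace
  KasparovModule.completeSpace KasparovModule.hilbertModule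

/-- `t : E₁ × E₂ → E` exhibits the Hilbert `C`-module `E` as the interior tensor product
`E₁ ⊗_φ E₂` of a Hilbert `B`-module `E₁` and a Hilbert `C`-module `E₂` with a left action `φ` of
`B`: the elementary tensors span a dense subspace and
`⟨x ⊗ y, x' ⊗ y'⟩ = ⟨y, φ(⟨x, x'⟩) y'⟩`. This determines `E` up to a unique unitary. -/
structure IsInteriorTensor {B C E₁ E₂ E : Type*} [NonUnitalCStarAlgebra B]
    [NonUnitalCStarAlgebra C] [NormedAddCommGroup E₁] [NormedSpace ℂ E₁] [HilbertModule B E₁]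
    [NormedAddCommGroup E₂] [NormedSpace ℂ E₂] [HilbertModule C E₂]
    [NormedAddCommGroup E] [NormedSpace ℂ E] [HilbertModule C E]
    (φ : B → E₂ → E₂) (t : E₁ →L[ℂ] E₂ →L[ℂ] E) : Prop where
  ip_tmul : ∀ (x x' : E₁) (y y' : E₂),
    (HilbertModule.ip (t x y) (t x' y') : C) = HilbertModule.ip y (φ (HilbertModule.ip x x') y')
  dense_span : Dense (Submodule.span ℂ {z : E | ∃ x y, z = t x y} : Set E)

/-- `y` is (unitarily equivalent to) the push-forward `ψ_*(x) = x ⊗_ψ C` of the Kasparov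
`(A, B)`-module `x` along a *-homomorphism `ψ : B → C`. -/
def IsPushforward {A B C : Type u} [NonUnitalCStarAlgebra A] [NonUnitalCStarAlgebra B]
    [NonUnitalCStarAlgebra C] (ψ : B →⋆ₙₐ[ℂ] C) (x : KasparovModule A B)
    (y : KasparovModule A C) : Prop :=
  ∃ t : x.E →L[ℂ] C →L[ℂ] y.E,
    IsInteriorTensor (B := B) (C := C) (fun b c => ψ b * c) t ∧
    (∀ e c, y.γ (t e c) = t (x.γ e) c) ∧
    (∀ a e c, y.φ a (t e c) = t (x.φ a e) c) ∧
    (∀ e c, y.F (t e c) = t (x.F e) c)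

/-- Evaluation at a point `s ∈ [0, 1]`. -/
def evalHom {B : Type*} [NonUnitalCStarAlgebra B] (s : unitInterval) :
    C(unitInterval, B) →⋆ₙₐ[ℂ] B where
  toFun f := f s
  map_smul' _ _ := rfl
  map_zero' := rfl
  map_add' _ _ := rfl
  map_mul' _ _ := rfl
  map_star' _ := rfl

/-- Homotopy of Kasparov modules, through a Kasparov `(A, C([0, 1], B))`-module. -/
def KasparovModule.Homotopic {A B : Type u} [NonUnitalCStarAlgebra A] [NonUnitalCStarAlgebra B]
    (x y : KasparovModule A B) : Prop :=
  ∃ z : KasparovModule A C(unitInterval, B),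
    IsPushforward (evalHom 0) z x ∧ IsPushforward (evalHom 1) z y

/-- `z` is a Kasparov product of the Kasparov modules `x` and `y`, over `B`: its module is
`x.E ⊗_B y.E` with the graded tensor product grading and the left action of `A` on `x.E`, its
operator `F` is a `y.F`-connection, and `φ(a) [x.F ⊗ 1, F] φ(a)* ≥ 0` modulo compact operators, where
`[·, ·]` is the graded commutator of two odd operators.

For homogeneous `e` of degree `∂e`, with `ε = (-1)^∂e` and `T_e f = e ⊗ f`, the connection condition
is that `T_e F₂ - ε F T_e` and `F₂ T_e* - ε T_e* F` are compact; the second operator is replaced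
here by its adjoint `T_e F₂* - ε F* T_e`. -/
def IsKasparovProduct {A B C : Type u} [NonUnitalCStarAlgebra A] [NonUnitalCStarAlgebra B]
    [NonUnitalCStarAlgebra C] (x : KasparovModule A B) (y : KasparovModule B C)
    (z : KasparovModule A C) : Prop :=
  ∃ t : x.E →L[ℂ] y.E →L[ℂ] z.E,
    IsInteriorTensor (B := B) (C := C) (fun b f => y.φ b f) t ∧
    (∀ e f, z.γ (t e f) = t (x.γ e) (y.γ f)) ∧
    (∀ a e f, z.φ a (t e f) = t (x.φ a e) f) ∧
    (∀ (e : x.E) (ε : ℂ), (ε = 1 ∨ ε = -1) → x.γ e = ε • e →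
      t e ∘L y.F - ε • (z.F ∘L t e) ∈ compacts C y.E z.E ∧
      t e ∘L y.Fstar - ε • (z.Fstar ∘L t e) ∈ compacts C y.E z.E) ∧
    ∃ F₁ : z.E →L[ℂ] z.E, (∀ e f, F₁ (t e f) = t (x.F e) f) ∧
      ∀ a : A, ∃ Q : z.E →L[ℂ] z.E,
        (∀ w, ∃ c : C, HilbertModule.ip w (Q w) = star c * c) ∧
        z.φ a * (F₁ * z.F + z.F * F₁) * z.φ (star a) - Q ∈ compacts C z.E z.E

/- The groups `KK(A, B)`, as sets of homotopy classes, with the Kasparov product. -/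

/-- `KK(A, B)`: homotopy classes of Kasparov `(A, B)`-modules. -/
def KK (A B : Type u) [NonUnitalCStarAlgebra A] [NonUnitalCStarAlgebra B] : Type (u + 1) :=
  Quot (KasparovModule.Homotopic (A := A) (B := B))

/-- The class of a Kasparov module. -/
def KK.mk {A B : Type u} [NonUnitalCStarAlgebra A] [NonUnitalCStarAlgebra B]
    (x : KasparovModule A B) : KK A B :=
  Quot.mk _ x

/-- `z ∈ KK(A, C)` is the Kasparov product `x ⊗_B y`. -/
def KK.IsProduct {A B C : Type u} [NonUnitalCStarAlgebra A] [NonUnitalCStarAlgebra B]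
    [NonUnitalCStarAlgebra C] (x : KK A B) (y : KK B C) (z : KK A C) : Prop :=
  ∃ (x' : KasparovModule A B) (y' : KasparovModule B C) (z' : KasparovModule A C),
    KK.mk x' = x ∧ KK.mk y' = y ∧ KK.mk z' = z ∧ IsKasparovProduct x' y' z'

theorem exists_approx_unit {B : Type*} [NonUnitalCStarAlgebra B] :
    ∃ l : Filter B, l.NeBot ∧ ∀ b : B, Filter.Tendsto (fun e => b * e) l (nhds b) := by
  let _ := CStarAlgebra.spectralOrder B
  let _ := CStarAlgebra.spectralOrderedRing B
  exact ⟨CStarAlgebra.approximateUnit B, inferInstance, fun b =>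
    (CStarAlgebra.increasingApproximateUnit B).tendsto_mul_left b⟩

theorem mul_left_compact {B : Type*} [NonUnitalCStarAlgebra B] (b : B) :
    ContinuousLinearMap.mul ℂ B b ∈ compacts B B B := by
  obtain ⟨l, hl, h⟩ := exists_approx_unit (B := B)
  refine mem_closure_of_tendsto
    (((ContinuousLinearMap.mul ℂ B).continuous.tendsto b).comp (h b)) ?_
  refine Filter.Eventually.of_forall fun e => Submodule.subset_span ⟨b, star e, fun z => ?_⟩
  simp [HilbertModule.act, HilbertModule.ip, mul_assoc]

theorem countablyGenerated_self (B : Type*) [NonUnitalCStarAlgebra B]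
    [TopologicalSpace.SeparableSpace B] : CountablyGenerated B B := by
  obtain ⟨s, hs, hd⟩ := TopologicalSpace.exists_countable_dense B
  refine ⟨s, hs, fun b => ?_⟩
  obtain ⟨l, hl, h⟩ := exists_approx_unit (B := B)
  rw [← closure_closure]
  refine mem_closure_of_tendsto (h b) ?_
  refine Filter.Eventually.of_forall fun e => ?_
  have hb : b ∈ closure s := hd b
  have hc : Continuous fun x : B => x * e := continuous_id.mul continuous_const
  refine closure_mono ?_ (image_closure_subset_closure_image hc ⟨b, hb, rfl⟩)
  rintro _ ⟨x, hx, rfl⟩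
  exact Submodule.subset_span ⟨x, hx, e, rfl⟩

/-- The Kasparov module `(B, f, 0)` of a *-homomorphism `f : A → B` of separable C*-algebras. -/
def KasparovModule.ofHom {A B : Type u} [NonUnitalCStarAlgebra A] [NonUnitalCStarAlgebra B]
    [TopologicalSpace.SeparableSpace B] (f : A →⋆ₙₐ[ℂ] B) : KasparovModule A B where
  E := B
  countablyGenerated := countablyGenerated_self B
  γ := 1
  γ_sq := one_mul 1
  γ_ip _ _ := rfl
  φ :=
    { toFun := fun a => ContinuousLinearMap.mul ℂ B (f a)
      map_smul' := fun c a => by ext; simp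
      map_zero' := by ext; simp
      map_add' := fun a b => by ext; simp
      map_mul' := fun a b => by ext; simp [mul_assoc] }
  φ_star a x y := by simp [HilbertModule.ip, mul_assoc, map_star]
  φ_even a := rfl
  F := 0
  Fstar := 0
  F_adjoint x y := by simp [HilbertModule.ip]
  F_odd := by simp
  commutator_compact a := by simp
  sq_compact a := by
    have := Submodule.neg_mem _ (mul_left_compact (f a))
    simpa using this
  selfAdjoint_compact a := by simp

/-- The class `KK(f) ∈ KK(A, B)` of a *-homomorphism `f : A → B`. -/
def KK.ofHom {A B : Type u} [NonUnitalCStarAlgebra A] [NonUnitalCStarAlgebra B]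
    [TopologicalSpace.SeparableSpace B] (f : A →⋆ₙₐ[ℂ] B) : KK A B :=
  KK.mk (KasparovModule.ofHom f)

/-- The unit `1_A ∈ KK(A, A)`. -/
def KK.one (A : Type u) [NonUnitalCStarAlgebra A] [TopologicalSpace.SeparableSpace A] : KK A A :=
  KK.ofHom (NonUnitalStarAlgHom.id ℂ A)

/-- `x ∈ KK(A, B)` is a KK-equivalence: it is invertible for the Kasparov product. -/
def KK.IsEquivalence {A B : Type u} [NonUnitalCStarAlgebra A] [NonUnitalCStarAlgebra B]
    [TopologicalSpace.SeparableSpace A] [TopologicalSpace.SeparableSpace B] (x : KK A B) : Prop :=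
  ∃ y : KK B A, KK.IsProduct x y (KK.one A) ∧ KK.IsProduct y x (KK.one B)

end OreDilation

end

open OreDilation

/-!
The proof has an operator-theoretic half, which identifies `C*_r(P)` with a full corner of the
crossed product, and a half about KK-theory, which shows that the inclusion of any full corner is a
KK-equivalence.

*The corner.* The algebra `D_r^{(∞)}(P)` consists of operators on `ℓ²(G)` that are diagonal in the
standard basis (`dilatedAlgebra_le_diagonalOps`). For such a diagonal action the reduced crossed
product is spatially an amplification: a unitary `Ω` of `ℓ²(G, ℓ²(G))` turns `T ⊗ 1` into the
canonical copy of `T` in the crossed product, both for `T = λ_g` (`ampRep_lamOp`) and for `T` in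
`D_r^{(∞)}(P)` (`ampRep_dilatedAlgebra`). So the crossed product may be replaced by the closed span
of the operators `π_p(d) λ_g = λ_p* d λ_p λ_g` on `ℓ²(G)` (`dilatedCrossed_le_closed_submodule`),
and `C*_r(P)` by the algebra generated by `V_p = E_P λ_p E_P = λ_p E_P`. Fullness of `E_P` is then
the factorization `π_p(d) λ_g = (λ_p* E_P) E_P (d λ_{pg})`. If `p g = a⁻¹ b` with `a, b ∈ P`, the
compression of `π_p(d) λ_g` to `ℓ²(P)` is `V_p* d V_a* V_b` (`compression_eq`), which lies in
`C*_r(P)` because `D_r(P) ⊆ C*_r(P)`. Hence the corner is exactly the image of `C*_r(P)`.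

*KK-equivalence.* Let `A ≅ e B e` with `e` full. All Kasparov modules that occur have operator `0`,
with the algebra acting by compact operators, so that the Kasparov product is the interior tensor
product (`isKasparovProduct_of_operator_eq_zero`). The inverse of the class of `A → B` is the class
of the bimodule `B e`, on which `B` acts by compact operators because `B e B` is dense. One of the
two products is `B e ⊗_A B = B`. For the other, `(B, ι, 0)` is first replaced by the homotopic
module `(e B, ι, 0)`, the homotopy being the module of the paths in `B` that end in `e B`
(`homotopic_ofRightIdeal`); then `e B ⊗_B B e = e B e ≅ A`.

Separability for countable `P` comes down to `P` having only countably many constructible ideals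
(`countable_constructible`). -/

namespace OreDilation

theorem continuous_starHom {A B : Type*} [NonUnitalCStarAlgebra A] [NonUnitalCStarAlgebra B]
    (f : A →⋆ₙₐ[ℂ] B) : Continuous f :=
  AddMonoidHomClass.continuous_of_bound f 1 fun a => by
    simpa using NonUnitalStarAlgHom.norm_apply_le f a

/-! ### Closed right ideals as Hilbert modules -/

/-- A closed right ideal of a C*-algebra `B`, regarded as a Hilbert `B`-submodule of `B`. -/
structure ClosedRightIdeal (B : Type*) [NonUnitalCStarAlgebra B] extends Submodule ℂ B where
  mul_mem' : ∀ x ∈ carrier, ∀ b : B, x * b ∈ carrier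
  isClosed' : IsClosed carrier

namespace ClosedRightIdeal

variable {B : Type*} [NonUnitalCStarAlgebra B] (R : ClosedRightIdeal B)

theorem mul_mem {x : B} (hx : x ∈ R.toSubmodule) (b : B) : x * b ∈ R.toSubmodule :=
  R.mul_mem' x hx b

instance : CompleteSpace R.toSubmodule := R.isClosed'.completeSpace_coe

instance : HilbertModule B R.toSubmodule where
  act x b := ⟨x * b, R.mul_mem x.2 b⟩
  ip x y := star (x : B) * y
  ip_add x y z := mul_add _ _ _
  ip_smul c x y := mul_smul_comm _ _ _
  ip_act x y b := (mul_assoc _ _ _).symm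
  star_ip x y := by simp
  ip_self x := ⟨x, rfl⟩
  norm_sq x := by rw [CStarRing.norm_star_mul_self, sq]; rfl

theorem ip_def (x y : R.toSubmodule) : (HilbertModule.ip x y : B) = star (x : B) * y := rfl

theorem coe_act (x : R.toSubmodule) (b : B) :
    (HilbertModule.act x b : R.toSubmodule) = (x : B) * b := rfl

theorem dense_span_mul :
    Dense (Submodule.span ℂ {z : R.toSubmodule | ∃ (x : R.toSubmodule) (b : B), (z : B) = x * b} :
      Set R.toSubmodule) := by
  intro x
  obtain ⟨l, hl, h⟩ := exists_approx_unit (B := B)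
  have h' : Filter.Tendsto (fun b => (⟨x * b, R.mul_mem x.2 b⟩ : R.toSubmodule)) l (nhds x) :=
    tendsto_subtype_rng.2 (h x)
  exact mem_closure_of_tendsto h'
    (Filter.Eventually.of_forall fun b => Submodule.subset_span ⟨x, b, rfl⟩)

theorem countablyGenerated [TopologicalSpace.SeparableSpace B] :
    CountablyGenerated B R.toSubmodule := by
  have : SecondCountableTopology B := UniformSpace.secondCountable_of_separable B
  obtain ⟨s, hs, hd⟩ := TopologicalSpace.exists_countable_dense R.toSubmodule
  refine ⟨s, hs, fun x => ?_⟩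
  obtain ⟨l, hl, h⟩ := exists_approx_unit (B := B)
  have h' : Filter.Tendsto (fun b => (⟨x * b, R.mul_mem x.2 b⟩ : R.toSubmodule)) l (nhds x) :=
    tendsto_subtype_rng.2 (h x)
  rw [← closure_closure]
  refine mem_closure_of_tendsto h' (Filter.Eventually.of_forall fun b => ?_)
  have hc : Continuous fun y : R.toSubmodule => (⟨y * b, R.mul_mem y.2 b⟩ : R.toSubmodule) :=
    Continuous.subtype_mk (continuous_subtype_val.mul continuous_const) _
  refine closure_mono ?_ (image_closure_subset_closure_image hc ⟨x, hd x, rfl⟩)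
  rintro _ ⟨y, hy, rfl⟩
  exact Submodule.subset_span ⟨y, hy, b, rfl⟩

/-- Left multiplication on a closed right ideal `R` by the elements of `R`. -/
noncomputable def mulLeft : R.toSubmodule →L[ℂ] R.toSubmodule →L[ℂ] R.toSubmodule :=
  LinearMap.mkContinuous₂
    (LinearMap.mk₂ ℂ (fun x y : R.toSubmodule => (⟨x * y, R.mul_mem x.2 y⟩ : R.toSubmodule))
      (fun x y z => Subtype.ext (add_mul _ _ _)) (fun c x y => Subtype.ext (smul_mul_assoc _ _ _))
      (fun x y z => Subtype.ext (mul_add _ _ _)) (fun c x y => Subtype.ext (mul_smul_comm _ _ _)))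
    1 fun x y => by rw [one_mul]; exact norm_mul_le (x : B) y

@[simp]
theorem coe_mulLeft (x y : R.toSubmodule) : (R.mulLeft x y : B) = x * y := rfl

end ClosedRightIdeal

/-- If a *-homomorphism `f : A → B` takes its values in a closed right ideal `R` of `B`, then `A`
acts on `R` by compact operators through `f`, which gives the Kasparov module `(R, f, 0)`. -/
noncomputable def KasparovModule.ofRightIdeal {A B : Type u} [NonUnitalCStarAlgebra A]
    [NonUnitalCStarAlgebra B] [TopologicalSpace.SeparableSpace B] (R : ClosedRightIdeal B)
    (f : A →⋆ₙₐ[ℂ] B) (hf : ∀ a, f a ∈ R.toSubmodule) : KasparovModule A B where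
  E := R.toSubmodule
  countablyGenerated := R.countablyGenerated
  γ := 1
  γ_sq := one_mul 1
  γ_ip _ _ := rfl
  φ :=
    { toFun := fun a => R.mulLeft ⟨f a, hf a⟩
      map_smul' := fun c a => by ext; simp [smul_mul_assoc]
      map_zero' := by ext; simp
      map_add' := fun a b => by ext; simp [add_mul]
      map_mul' := fun a b => by ext; simp [mul_assoc] }
  φ_star a x y := by simp [R.ip_def, mul_assoc, map_star]
  φ_even a := rfl
  F := 0
  Fstar := 0
  F_adjoint x y := by simp [R.ip_def]
  F_odd := by simp
  commutator_compact a := by simp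
  sq_compact a := by
    have key : R.mulLeft ⟨f a, hf a⟩ ∈ compacts B R.toSubmodule R.toSubmodule := by
      -- `f a * f e` acts as the rank one operator of `f a` and `f (star e)`, and tends to `f a`.
      obtain ⟨l, hl, h⟩ := exists_approx_unit (B := A)
      have hc : Continuous fun a : A => R.mulLeft ⟨f a, hf a⟩ :=
        R.mulLeft.continuous.comp
          ((continuous_starHom f).subtype_mk hf)
      refine mem_closure_of_tendsto ((hc.tendsto a).comp (h a))
        (Filter.Eventually.of_forall fun e => Submodule.subset_span
          ⟨⟨f a, hf a⟩, ⟨f (star e), hf _⟩, fun z => Subtype.ext ?_⟩)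
      simp [R.ip_def, R.coe_act, map_star, mul_assoc]
    simpa using Submodule.neg_mem _ key
  selfAdjoint_compact a := by simp

/-! ### The homotopy between a module and its essential part -/

/-- For a closed right ideal `R` of `B`, the ideal of the `g ∈ C([0, 1], B)` with `g 1 ∈ R`. -/
def ClosedRightIdeal.path {B : Type*} [NonUnitalCStarAlgebra B] (R : ClosedRightIdeal B) :
    ClosedRightIdeal C(unitInterval, B) where
  carrier := {g | g 1 ∈ R.toSubmodule}
  add_mem' hx hy := R.add_mem hx hy
  zero_mem' := R.zero_mem
  smul_mem' c _ hx := R.smul_mem c hx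
  mul_mem' _ hx b := R.mul_mem hx (b 1)
  isClosed' := R.isClosed'.preimage (continuous_eval_const 1)

/-- The *-homomorphism `a ↦ (s ↦ f a)` from `A` to `C([0, 1], B)`. -/
def constHom {A B : Type*} [NonUnitalCStarAlgebra A] [NonUnitalCStarAlgebra B]
    (f : A →⋆ₙₐ[ℂ] B) : A →⋆ₙₐ[ℂ] C(unitInterval, B) where
  toFun a := ContinuousMap.const _ (f a)
  map_smul' c a := by ext; simp
  map_zero' := by ext; simp
  map_add' a b := by ext; simp
  map_mul' a b := by ext; simp
  map_star' a := by ext; simp [map_star]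

theorem norm_evalHom_le {B : Type*} [NonUnitalCStarAlgebra B] (s : unitInterval)
    (g : C(unitInterval, B)) : ‖g s‖ ≤ ‖g‖ := ContinuousMap.norm_coe_le_norm g s

/-- The Kasparov modules `(B, f, 0)` and `(R, f, 0)` are homotopic: the homotopy is the module of
the paths in `B` that end in `R`. -/
theorem homotopic_ofRightIdeal {A B : Type u} [NonUnitalCStarAlgebra A]
    [NonUnitalCStarAlgebra B] [TopologicalSpace.SeparableSpace B] (R : ClosedRightIdeal B)
    (f : A →⋆ₙₐ[ℂ] B) (hf : ∀ a, f a ∈ R.toSubmodule) :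
    (KasparovModule.ofHom f).Homotopic (KasparovModule.ofRightIdeal R f hf) := by
  have : SecondCountableTopology B := UniformSpace.secondCountable_of_separable B
  refine ⟨KasparovModule.ofRightIdeal R.path (constHom f) hf, ?_, ?_⟩
  · let t : R.path.toSubmodule →L[ℂ] B →L[ℂ] B := LinearMap.mkContinuous₂
      (LinearMap.mk₂ ℂ (fun (x : R.path.toSubmodule) (y : B) => x.1 0 * y)
        (fun x y z => add_mul _ _ _) (fun c x y => smul_mul_assoc _ _ _)
        (fun x y z => mul_add _ _ _) (fun c x y => mul_smul_comm _ _ _))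
      1 fun x y => by
        rw [one_mul]
        exact (norm_mul_le (x.1 0) y).trans
          (mul_le_mul_of_nonneg_right (norm_evalHom_le 0 x.1) (norm_nonneg y))
    refine ⟨t, ⟨?_, ?_⟩, fun _ _ => rfl, ?_, ?_⟩
    · intro x x' y y'
      change star (x.1 0 * y) * (x'.1 0 * y') = star y * (star (x.1 0) * x'.1 0 * y')
      simp [mul_assoc]
    · intro (b : B)
      obtain ⟨l, hl, h⟩ := exists_approx_unit (B := B)
      refine mem_closure_of_tendsto (h b) (Filter.Eventually.of_forall fun c =>
        Submodule.subset_span ?_)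
      -- The path from `b` to `0` ends in `R`, so every `b` is the value at `0` of an element.
      let g : C(unitInterval, B) := ⟨fun s => ((1 - (s : ℝ) : ℝ) : ℂ) • b,
        (Complex.continuous_ofReal.comp (continuous_const.sub continuous_subtype_val)).smul
          continuous_const⟩
      refine ⟨⟨g, ?_⟩, c, ?_⟩
      · change ((1 - ((1 : unitInterval) : ℝ) : ℝ) : ℂ) • b ∈ R.toSubmodule
        simp
      · change (b : B) * c = ((1 - ((0 : unitInterval) : ℝ) : ℝ) : ℂ) • (b : B) * c
        simp
    · intro a x c
      exact (mul_assoc (f a) (x.1 0) c).symm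
    · intro x c
      change (0 : B) = t 0 c
      simp
  · let t : R.path.toSubmodule →L[ℂ] B →L[ℂ] R.toSubmodule := LinearMap.mkContinuous₂
      (LinearMap.mk₂ ℂ (fun (x : R.path.toSubmodule) (y : B) =>
          (⟨x.1 1 * y, R.mul_mem x.2 y⟩ : R.toSubmodule))
        (fun x y z => Subtype.ext (add_mul _ _ _))
        (fun c x y => Subtype.ext (smul_mul_assoc _ _ _))
        (fun x y z => Subtype.ext (mul_add _ _ _))
        (fun c x y => Subtype.ext (mul_smul_comm _ _ _)))
      1 fun x y => by
        rw [one_mul]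
        exact (norm_mul_le (x.1 1) y).trans
          (mul_le_mul_of_nonneg_right (norm_evalHom_le 1 x.1) (norm_nonneg y))
    refine ⟨t, ⟨?_, ?_⟩, fun _ _ => rfl, ?_, ?_⟩
    · intro x x' y y'
      change star (x.1 1 * y) * (x'.1 1 * y') = star y * (star (x.1 1) * x'.1 1 * y')
      simp [mul_assoc]
    · refine R.dense_span_mul.mono (Submodule.span_mono ?_)
      rintro z ⟨x, b, hz⟩
      exact ⟨⟨ContinuousMap.const _ x.1, x.2⟩, b, Subtype.ext hz⟩
    · intro a x c
      exact Subtype.ext (mul_assoc (f a) (x.1 1) c).symm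
    · intro x c
      change (0 : R.toSubmodule) = t 0 c
      simp

/-! ### Full corners are KK-equivalent to the ambient algebra -/

/-- An identification of the C*-algebra `A` with the corner `e B e` of a projection `e` in a
C*-algebra `B`: an injective *-homomorphism `A → B` with image `e B e`. -/
structure CornerIso (A B : Type*) [NonUnitalCStarAlgebra A] [NonUnitalCStarAlgebra B] where
  toHom : A →⋆ₙₐ[ℂ] B
  e : B
  isStarProjection : IsStarProjection e
  injective : Injective toHom
  range_eq : Set.range toHom = corner e

namespace CornerIso

variable {A B : Type*} [NonUnitalCStarAlgebra A] [NonUnitalCStarAlgebra B] (c : CornerIso A B)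

theorem e_mul_e : c.e * c.e = c.e := c.isStarProjection.isIdempotentElem

theorem star_e : star c.e = c.e := c.isStarProjection.isSelfAdjoint

theorem e_mul_e_mul (x : B) : c.e * (c.e * x) = c.e * x := by rw [← mul_assoc, c.e_mul_e]

theorem e_mul_toHom (a : A) : c.e * c.toHom a = c.toHom a := by
  obtain ⟨b, hb⟩ : c.toHom a ∈ corner c.e := c.range_eq ▸ ⟨a, rfl⟩
  rw [hb, mul_assoc, c.e_mul_e_mul]

theorem toHom_mul_e (a : A) : c.toHom a * c.e = c.toHom a := by
  obtain ⟨b, hb⟩ : c.toHom a ∈ corner c.e := c.range_eq ▸ ⟨a, rfl⟩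
  rw [hb, mul_assoc, c.e_mul_e]

theorem exists_toHom_eq {x : B} (h1 : c.e * x = x) (h2 : x * c.e = x) : ∃ a, c.toHom a = x := by
  have : x ∈ corner c.e := ⟨x, by rw [h1, h2]⟩
  rwa [← c.range_eq] at this

theorem norm_toHom (a : A) : ‖c.toHom a‖ = ‖a‖ :=
  (AddMonoidHomClass.isometry_iff_norm _).1
    (NonUnitalStarAlgHom.isometry c.toHom c.injective) a

/-- The inverse of the isomorphism of `A` onto `e B e`, extended by a junk value to `B`. -/
noncomputable def inv (x : B) : A := invFun c.toHom x

theorem toHom_inv {x : B} (h1 : c.e * x = x) (h2 : x * c.e = x) : c.toHom (c.inv x) = x :=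
  invFun_eq (c.exists_toHom_eq h1 h2)

/-- The `B`-`A`-bimodule `B e`. -/
def bimod : Submodule ℂ B where
  carrier := {x | x * c.e = x}
  add_mem' {x y} hx hy := by
    change (x + y) * c.e = x + y
    rw [add_mul, hx, hy]
  zero_mem' := zero_mul _
  smul_mem' z x hx := by
    change (z • x) * c.e = z • x
    rw [smul_mul_assoc, hx]

theorem mul_e (x : c.bimod) : (x : B) * c.e = x := x.2

theorem e_mul_star (x : c.bimod) : c.e * star (x : B) = star (x : B) := by
  conv_rhs => rw [← c.mul_e x, star_mul, c.star_e]

theorem mul_mem_bimod (b : B) (x : c.bimod) : b * (x : B) ∈ c.bimod := by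
  change b * x * c.e = b * x
  rw [mul_assoc, c.mul_e]

theorem isClosed_bimod : IsClosed (c.bimod : Set B) :=
  isClosed_eq (continuous_id.mul continuous_const) continuous_id

instance : CompleteSpace c.bimod := c.isClosed_bimod.completeSpace_coe

theorem toHom_inv_star_mul (x y : c.bimod) :
    c.toHom (c.inv (star (x : B) * y)) = star (x : B) * y :=
  c.toHom_inv (by rw [← mul_assoc, c.e_mul_star]) (by rw [mul_assoc, c.mul_e])

theorem exists_inv_star_mul_self (x : c.bimod) :
    ∃ a : A, c.inv (star (x : B) * x) = star a * a := by
  let _ := CStarAlgebra.spectralOrder B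
  let _ := CStarAlgebra.spectralOrderedRing B
  have h0 : 0 ≤ star (x : B) * x := star_mul_self_nonneg _
  obtain ⟨s, hs, hss⟩ : ∃ s : B, star s = s ∧ s * s = star (x : B) * x :=
    ⟨CFC.sqrt (star (x : B) * x), (IsSelfAdjoint.of_nonneg (CFC.sqrt_nonneg _)).star_eq,
      CFC.sqrt_mul_sqrt_self _ h0⟩
  have he : star (x : B) * x * c.e = star (x : B) * x := by rw [mul_assoc, c.mul_e]
  have h1 : s * c.e = s := by
    -- `‖s e - s‖² = ‖(e - 1) s² (e - 1)‖` vanishes because `s² = x* x` and `x e = x`.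
    rw [← sub_eq_zero, ← CStarRing.star_mul_self_eq_zero_iff, star_sub, star_mul, hs, c.star_e,
      sub_mul, mul_sub, mul_sub, mul_assoc, ← mul_assoc s s, hss, he, mul_assoc, hss, sub_self,
      sub_self, sub_self]
  have h2 : c.e * s = s := by
    have := congrArg star h1
    rwa [star_mul, hs, c.star_e] at this
  refine ⟨c.inv s, c.injective ?_⟩
  rw [c.toHom_inv_star_mul, map_mul, map_star, c.toHom_inv h2 h1, hs, hss]

/-- `B e` as a Hilbert `A`-module, `⟨x, y⟩ = x* y ∈ e B e ≅ A`. -/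
noncomputable instance : HilbertModule A c.bimod where
  act x a := ⟨x * c.toHom a, by
    change (x : B) * c.toHom a * c.e = _
    rw [mul_assoc, c.toHom_mul_e]⟩
  ip x y := c.inv (star (x : B) * y)
  ip_add x y z := c.injective <| by
    rw [map_add, c.toHom_inv_star_mul, c.toHom_inv_star_mul, c.toHom_inv_star_mul]
    exact mul_add _ _ _
  ip_smul z x y := c.injective <| by
    rw [map_smul, c.toHom_inv_star_mul, c.toHom_inv_star_mul]
    exact mul_smul_comm _ _ _
  ip_act x y a := c.injective <| by
    rw [map_mul, c.toHom_inv_star_mul, c.toHom_inv_star_mul]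
    exact (mul_assoc _ _ _).symm
  star_ip x y := c.injective <| by
    simp only [map_star, c.toHom_inv_star_mul, star_mul, star_star]
  ip_self := c.exists_inv_star_mul_self
  norm_sq x := by
    rw [← c.norm_toHom, c.toHom_inv_star_mul, CStarRing.norm_star_mul_self, sq]
    rfl

theorem ip_def (x y : c.bimod) : (HilbertModule.ip x y : A) = c.inv (star (x : B) * y) := rfl

theorem toHom_ip (x y : c.bimod) : c.toHom (HilbertModule.ip x y : A) = star (x : B) * y :=
  c.toHom_inv_star_mul x y

theorem coe_act (x : c.bimod) (a : A) : (HilbertModule.act x a : c.bimod) = (x : B) * c.toHom a :=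
  rfl

/-- The left action of `B` on `B e`. -/
noncomputable def mulLeft : B →L[ℂ] c.bimod →L[ℂ] c.bimod :=
  LinearMap.mkContinuous₂
    (LinearMap.mk₂ ℂ (fun (b : B) (x : c.bimod) => (⟨b * x, c.mul_mem_bimod b x⟩ : c.bimod))
      (fun x y z => Subtype.ext (add_mul _ _ _)) (fun c x y => Subtype.ext (smul_mul_assoc _ _ _))
      (fun x y z => Subtype.ext (mul_add _ _ _)) (fun c x y => Subtype.ext (mul_smul_comm _ _ _)))
    1 fun b x => by rw [one_mul]; exact norm_mul_le b (x : B)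

@[simp]
theorem coe_mulLeft (b : B) (x : c.bimod) : (c.mulLeft b x : B) = b * x := rfl

/-- If `e` is full, then `B` acts on `B e` by compact operators, because `b₁ e b₂` acts as the rank
one operator of `b₁ e` and `b₂* e`. -/
theorem mulLeft_mem_compacts (he : IsFullProjection c.e) (b : B) :
    c.mulLeft b ∈ compacts A c.bimod c.bimod := by
  have hb : b ∈ (Submodule.span ℂ {x : B | ∃ b₁ b₂ : B, x = b₁ * c.e * b₂}).topologicalClosure :=
    he.full b
  refine Submodule.topologicalClosure_minimal _ (t := (compacts A c.bimod c.bimod).comap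
    (c.mulLeft : B →ₗ[ℂ] c.bimod →L[ℂ] c.bimod)) (Submodule.span_le.2 ?_)
    ((Submodule.isClosed_topologicalClosure _).preimage c.mulLeft.continuous) hb
  rintro _ ⟨b₁, b₂, rfl⟩
  refine Submodule.le_topologicalClosure _ (Submodule.subset_span
    ⟨⟨b₁ * c.e, ?_⟩, ⟨star b₂ * c.e, ?_⟩, fun z => Subtype.ext ?_⟩)
  · change b₁ * c.e * c.e = _
    rw [mul_assoc, c.e_mul_e]
  · change star b₂ * c.e * c.e = _
    rw [mul_assoc, c.e_mul_e]
  · rw [c.coe_act, c.toHom_ip]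
    simp only [ContinuousLinearMap.coe_coe, coe_mulLeft, star_mul, star_star, c.star_e, mul_assoc,
      c.e_mul_e_mul]

theorem countablyGenerated [TopologicalSpace.SeparableSpace B] : CountablyGenerated A c.bimod := by
  have : SecondCountableTopology B := UniformSpace.secondCountable_of_separable B
  obtain ⟨s, hs, hd⟩ := TopologicalSpace.exists_countable_dense c.bimod
  refine ⟨s, hs, hd.mono fun x hx => Submodule.subset_span ⟨x, hx, c.inv c.e, Subtype.ext ?_⟩⟩
  rw [c.coe_act, c.toHom_inv c.e_mul_e c.e_mul_e, c.mul_e]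

/-- The closed right ideal `e B`. -/
def rightIdeal : ClosedRightIdeal B where
  carrier := {x | c.e * x = x}
  add_mem' {x y} hx hy := by
    change c.e * (x + y) = x + y
    rw [mul_add, hx, hy]
  zero_mem' := mul_zero _
  smul_mem' z x hx := by
    change c.e * (z • x) = z • x
    rw [mul_smul_comm, hx]
  mul_mem' x hx b := by
    change c.e * (x * b) = x * b
    rw [← mul_assoc, hx]
  isClosed' := isClosed_eq (continuous_const.mul continuous_id) continuous_id

theorem e_mul (x : c.rightIdeal.toSubmodule) : c.e * (x : B) = x := x.2

theorem toHom_inv_mul (x : c.rightIdeal.toSubmodule) (y : c.bimod) :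
    c.toHom (c.inv ((x : B) * y)) = (x : B) * y :=
  c.toHom_inv (by rw [← mul_assoc, c.e_mul]) (by rw [mul_assoc, c.mul_e])

/-- The product `e B × B e → e B e ≅ A`. -/
noncomputable def pairing : c.rightIdeal.toSubmodule →L[ℂ] c.bimod →L[ℂ] A :=
  LinearMap.mkContinuous₂
    (LinearMap.mk₂ ℂ (fun x y => c.inv ((x : B) * y))
      (fun x y z => c.injective <| by
        rw [map_add, c.toHom_inv_mul, c.toHom_inv_mul, c.toHom_inv_mul]
        exact add_mul _ _ _)
      (fun z x y => c.injective <| by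
        rw [map_smul, c.toHom_inv_mul, c.toHom_inv_mul]
        exact smul_mul_assoc _ _ _)
      (fun x y z => c.injective <| by
        rw [map_add, c.toHom_inv_mul, c.toHom_inv_mul, c.toHom_inv_mul]
        exact mul_add _ _ _)
      (fun z x y => c.injective <| by
        rw [map_smul, c.toHom_inv_mul, c.toHom_inv_mul]
        exact mul_smul_comm _ _ _))
    1 fun x y => by
      rw [one_mul, ← c.norm_toHom]
      exact (congrArg norm (c.toHom_inv_mul x y)).le.trans (norm_mul_le (x : B) y)

theorem toHom_pairing (x : c.rightIdeal.toSubmodule) (y : c.bimod) :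
    c.toHom (c.pairing x y) = (x : B) * y := c.toHom_inv_mul x y

end CornerIso

/-- The Kasparov module `(B e, ·, 0)` of a full corner `A ≅ e B e`; its class is inverse to the
class of the inclusion `A → B`. -/
noncomputable def CornerIso.kasparovModule {A B : Type u} [NonUnitalCStarAlgebra A]
    [NonUnitalCStarAlgebra B] [TopologicalSpace.SeparableSpace B] (c : CornerIso A B)
    (he : IsFullProjection c.e) : KasparovModule B A where
  E := c.bimod
  countablyGenerated := c.countablyGenerated
  γ := 1
  γ_sq := one_mul 1
  γ_ip _ _ := rfl
  φ :=
    { toFun := c.mulLeft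
      map_smul' := fun z b => map_smul _ z b
      map_zero' := map_zero _
      map_add' := map_add _
      map_mul' := fun a b => by ext; simp [mul_assoc] }
  φ_star a x y := c.injective <| by simp [c.toHom_ip, mul_assoc]
  φ_even a := rfl
  F := 0
  Fstar := 0
  F_adjoint x y := by simp [c.ip_def]
  F_odd := by simp
  commutator_compact a := by simp
  sq_compact a := by simpa using Submodule.neg_mem _ (c.mulLeft_mem_compacts he a)
  selfAdjoint_compact a := by simp

/-- For Kasparov modules with operator `0`, the interior tensor product with operator `0` is a
Kasparov product. -/
theorem isKasparovProduct_of_operator_eq_zero {A B C : Type u} [NonUnitalCStarAlgebra A]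
    [NonUnitalCStarAlgebra B] [NonUnitalCStarAlgebra C] {x : KasparovModule A B}
    {y : KasparovModule B C} {z : KasparovModule A C} (hx : x.F = 0) (hy : y.F = 0)
    (hy' : y.Fstar = 0) (hz : z.F = 0) (hz' : z.Fstar = 0) (t : x.E →L[ℂ] y.E →L[ℂ] z.E)
    (ht : IsInteriorTensor (B := B) (C := C) (fun b f => y.φ b f) t)
    (hγ : ∀ e f, z.γ (t e f) = t (x.γ e) (y.γ f))
    (hφ : ∀ a e f, z.φ a (t e f) = t (x.φ a e) f) : IsKasparovProduct x y z := by
  refine ⟨t, ht, hγ, hφ, fun e ε _ _ => ?_, 0, fun e f => ?_, fun a => ⟨0, fun w => ⟨0, ?_⟩, ?_⟩⟩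
  · rw [hy, hy', hz, hz', ContinuousLinearMap.comp_zero, ContinuousLinearMap.zero_comp, smul_zero,
      sub_zero]
    exact ⟨Submodule.zero_mem _, Submodule.zero_mem _⟩
  · simp [hx]
  · -- `⟨w, 0⟩ = 0` follows from `⟨w, 0 • 0⟩ = 0 • ⟨w, 0⟩`.
    have h := HilbertModule.ip_smul (B := C) (0 : ℂ) w (0 : z.E)
    rw [zero_smul, zero_smul] at h
    rw [zero_apply, h, mul_zero]
  · simp

theorem CornerIso.isKasparovProduct_rightIdeal {A B : Type u} [NonUnitalCStarAlgebra A]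
    [NonUnitalCStarAlgebra B] [TopologicalSpace.SeparableSpace A]
    [TopologicalSpace.SeparableSpace B] (c : CornerIso A B) (he : IsFullProjection c.e) :
    IsKasparovProduct (KasparovModule.ofRightIdeal c.rightIdeal c.toHom c.e_mul_toHom)
      (c.kasparovModule he) (KasparovModule.ofHom (NonUnitalStarAlgHom.id ℂ A)) := by
  have hip : ∀ (x x' : c.rightIdeal.toSubmodule) (y y' : c.bimod),
      star (c.pairing x y) * c.pairing x' y' =
        (HilbertModule.ip y (c.mulLeft (star (x : B) * x') y') : A) := fun x x' y y' =>
    c.injective <| by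
      rw [map_mul, map_star, c.toHom_pairing, c.toHom_pairing, c.toHom_ip, c.coe_mulLeft]
      simp only [star_mul, mul_assoc]
  have hsurj : ∀ a : A, ∃ x y, a = c.pairing x y := fun a =>
    ⟨⟨c.e, c.e_mul_e⟩, ⟨c.toHom a, c.toHom_mul_e a⟩, c.injective <| by
      rw [c.toHom_pairing, c.e_mul_toHom]⟩
  have hact : ∀ (a : A) (x : c.rightIdeal.toSubmodule) (y : c.bimod), a * c.pairing x y =
      c.pairing (c.rightIdeal.mulLeft ⟨c.toHom a, c.e_mul_toHom a⟩ x) y := fun a x y =>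
    c.injective <| by
      rw [map_mul, c.toHom_pairing, c.toHom_pairing, ClosedRightIdeal.coe_mulLeft, mul_assoc]
  exact isKasparovProduct_of_operator_eq_zero rfl rfl rfl rfl rfl c.pairing
    ⟨hip, dense_univ.mono fun a _ => Submodule.subset_span (hsurj a)⟩ (fun _ _ => rfl) hact

theorem CornerIso.isKasparovProduct_bimod {A B : Type u} [NonUnitalCStarAlgebra A]
    [NonUnitalCStarAlgebra B] [TopologicalSpace.SeparableSpace B] (c : CornerIso A B)
    (he : IsFullProjection c.e) :
    IsKasparovProduct (c.kasparovModule he) (KasparovModule.ofHom c.toHom)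
      (KasparovModule.ofHom (NonUnitalStarAlgHom.id ℂ B)) := by
  let t : c.bimod →L[ℂ] B →L[ℂ] B := (ContinuousLinearMap.mul ℂ B).comp c.bimod.subtypeL
  have hip : ∀ (x x' : c.bimod) (y y' : B), star ((x : B) * y) * ((x' : B) * y') =
      star y * (c.toHom (HilbertModule.ip x x' : A) * y') := fun x x' y y' => by
    rw [c.toHom_ip]
    simp only [star_mul, mul_assoc]
  have hdense : Dense (Submodule.span ℂ {z : B | ∃ x y, z = t x y} : Set B) := by
    refine he.full.mono (Submodule.span_mono ?_)
    rintro _ ⟨b₁, b₂, rfl⟩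
    refine ⟨⟨b₁ * c.e, ?_⟩, b₂, rfl⟩
    change b₁ * c.e * c.e = _
    rw [mul_assoc, c.e_mul_e]
  have hact : ∀ (b : B) (x : c.bimod) (y : B), b * ((x : B) * y) = b * (x : B) * y :=
    fun b x y => (mul_assoc b (x : B) y).symm
  exact isKasparovProduct_of_operator_eq_zero rfl rfl rfl rfl rfl t ⟨hip, hdense⟩
    (fun _ _ => rfl) hact

/-- The inclusion of a full corner is a KK-equivalence. One composite is `e B ⊗_B B e = e B e`,
where `e B` replaces `B` up to homotopy; the other is `B e ⊗_A B`, which is the closure of `B e B`.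
-/
theorem CornerIso.isEquivalence {A B : Type u} [NonUnitalCStarAlgebra A]
    [NonUnitalCStarAlgebra B] [TopologicalSpace.SeparableSpace A]
    [TopologicalSpace.SeparableSpace B] (c : CornerIso A B) (he : IsFullProjection c.e) :
    (KK.ofHom c.toHom).IsEquivalence :=
  ⟨KK.mk (c.kasparovModule he),
    ⟨_, _, _, (Quot.sound (homotopic_ofRightIdeal c.rightIdeal c.toHom c.e_mul_toHom)).symm,
      rfl, rfl, c.isKasparovProduct_rightIdeal he⟩,
    ⟨_, _, _, rfl, rfl, rfl, c.isKasparovProduct_bimod he⟩⟩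

/-! ### Generators of C*-subalgebras -/

theorem cstarGen_le_closure_span {A : Type*} [NonUnitalCStarAlgebra A] (S : Set A) :
    (cstarGen S : Set A) ⊆
      closure (Submodule.span ℂ (Subsemigroup.closure (S ∪ star S) : Set A)) := by
  rw [← NonUnitalStarAlgebra.adjoin_eq_span]
  exact subset_rfl

theorem cstarGen_le_closed_submodule {A : Type*} [NonUnitalCStarAlgebra A] {S : Set A}
    (hmul : ∀ x ∈ S, ∀ y ∈ S, x * y ∈ S) (hstar : ∀ x ∈ S, star x ∈ S) {M : Submodule ℂ A}
    (hM : IsClosed (M : Set A)) (h : S ⊆ M) : (cstarGen S : Set A) ⊆ M := by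
  refine (cstarGen_le_closure_span S).trans (closure_minimal (Submodule.span_le.2 ?_) hM)
  let T : Subsemigroup A := ⟨S, fun hx hy => hmul _ hx _ hy⟩
  have hT : Subsemigroup.closure (S ∪ star S) ≤ T := by
    refine (Subsemigroup.closure_le).2 (Set.union_subset subset_rfl fun x hx => ?_)
    have := hstar _ (Set.mem_star.1 hx)
    rwa [star_star] at this
  exact fun x hx => h (hT hx)

theorem countable_subsemigroup_closure {A : Type*} [Semigroup A] {c : Set A} (hc : c.Countable) :
    (Subsemigroup.closure c : Set A).Countable := by
  have : Countable c := hc.to_subtype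
  have : Countable (FreeSemigroup c) :=
    Injective.countable (f := fun w : FreeSemigroup c => (w.head, w.tail)) fun v w h => by
      cases v; cases w; simpa using h
  let φ : FreeSemigroup c →ₙ* A := FreeSemigroup.lift Subtype.val
  refine (Set.countable_range φ).mono fun x hx => ?_
  exact (Subsemigroup.closure_le (S := φ.srange)).2
    (fun y hy => ⟨FreeSemigroup.of ⟨y, hy⟩, FreeSemigroup.lift_of _ _⟩) hx

theorem isSeparable_subsemigroup_closure {A : Type*} [NonUnitalCStarAlgebra A] {S : Set A}
    (hS : TopologicalSpace.IsSeparable S) :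
    TopologicalSpace.IsSeparable (Subsemigroup.closure S : Set A) := by
  obtain ⟨c, hc, hSc⟩ := hS
  refine ⟨Subsemigroup.closure c, countable_subsemigroup_closure hc, ?_⟩
  exact (Subsemigroup.closure_le (S := (Subsemigroup.closure c).topologicalClosure)).2
    (hSc.trans (closure_mono Subsemigroup.subset_closure))

theorem isSeparable_cstarGen {A : Type*} [NonUnitalCStarAlgebra A] {S : Set A}
    (hS : TopologicalSpace.IsSeparable S) : TopologicalSpace.IsSeparable (cstarGen S : Set A) := by
  refine (TopologicalSpace.IsSeparable.closure
    (isSeparable_subsemigroup_closure ?_).span).mono (cstarGen_le_closure_span S)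
  refine hS.union ?_
  have := hS.image (continuous_star (R := A))
  rwa [Set.image_star] at this

/-! ### Amplification of operators -/

/-- The amplification `T ↦ T ⊗ 1` of operators on `H` to `ℓ²(X, H) = H ⊗ ℓ²(X)`. -/
noncomputable def amp (X : Type*) {H : Type*} [NormedAddCommGroup H] [InnerProductSpace ℂ H]
    [CompleteSpace H] : Op H →⋆ₙₐ[ℂ] Op (Ell2 X H) where
  toFun T := lp.mapCLM 2 (fun _ : X => T) (norm_nonneg T) fun _ => le_rfl
  map_smul' c T := by ext; rfl
  map_zero' := by ext; rfl
  map_add' S T := by ext; rfl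
  map_mul' S T := by ext; rfl
  map_star' T := by
    rw [ContinuousLinearMap.star_eq_adjoint, ContinuousLinearMap.star_eq_adjoint,
      ContinuousLinearMap.eq_adjoint_iff]
    intro ξ η
    rw [lp.inner_eq_tsum, lp.inner_eq_tsum]
    exact tsum_congr fun x => T.adjoint_inner_left _ _

theorem amp_apply {X H : Type*} [NormedAddCommGroup H] [InnerProductSpace ℂ H]
    [CompleteSpace H] (T : Op H) (ξ : Ell2 X H) (x : X) : (amp X T ξ : Ell2 X H) x = T (ξ x) := rfl

theorem amp_single {X H : Type*} [NormedAddCommGroup H] [InnerProductSpace ℂ H]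
    [CompleteSpace H] (T : Op H) (x : X) (a : H) :
    amp X T (singleIsometry H x a) = singleIsometry H x (T a) := by
  classical
  ext y
  rw [amp_apply, singleIsometry_apply, singleIsometry_apply, apply_ite T, map_zero]

theorem amp_injective (X : Type*) {H : Type*} [NormedAddCommGroup H] [InnerProductSpace ℂ H]
    [CompleteSpace H] [Nonempty X] : Injective (amp X : Op H → Op (Ell2 X H)) := by
  intro S T h
  obtain ⟨x⟩ := ‹Nonempty X›
  ext a
  have := congrArg (fun R : Op (Ell2 X H) => R (singleIsometry H x a)) h
  simp only [amp_single] at this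
  exact (singleIsometry H x).injective this

theorem op_ext₂ {X Y : Type*} {S T : Op (Ell2 X (Ell2 Y ℂ))}
    (h : ∀ x y a, S (singleIsometry _ x (singleIsometry ℂ y a)) =
      T (singleIsometry _ x (singleIsometry ℂ y a))) : S = T := by
  refine op_ext fun x ξ => ?_
  have : S ∘L (singleIsometry (Ell2 Y ℂ) x).toContinuousLinearMap =
      T ∘L (singleIsometry (Ell2 Y ℂ) x).toContinuousLinearMap := op_ext fun y a => h x y a
  exact congr($this ξ)

/-- The isometry `ℓ²(G) → ℓ²(G, ℓ²(G))`, `ε_x ↦ ε_k ⊗ ε_{x k⁻¹}`. -/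
noncomputable def slice {G : Type*} [Group G] (k : G) : Ell2 G ℂ →ₗᵢ[ℂ] Ell2 G (Ell2 G ℂ) :=
  OrthogonalFamily.linearIsometry (𝕜 := ℂ) (G := fun _ : G => ℂ)
    (V := fun x => (singleIsometry (Ell2 G ℂ) (x * k⁻¹)).comp (singleIsometry ℂ k)) <| by
      intro x y hxy a b
      classical
      change inner ℂ (singleIsometry (Ell2 G ℂ) (x * k⁻¹) (singleIsometry ℂ k a))
        (singleIsometry (Ell2 G ℂ) (y * k⁻¹) (singleIsometry ℂ k b)) = 0
      rw [inner_single, singleIsometry_apply, if_neg (fun h => hxy (mul_right_cancel h)),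
        inner_zero_right]

theorem slice_single {G : Type*} [Group G] (k x : G) (a : ℂ) :
    slice k (singleIsometry ℂ x a) = singleIsometry _ (x * k⁻¹) (singleIsometry ℂ k a) := by
  classical
  have e : (singleIsometry ℂ x a : Ell2 G ℂ) = lp.single (E := fun _ : G => ℂ) 2 x a :=
    singleIsometry_def x a
  rw [e]
  exact OrthogonalFamily.linearIsometry_apply_single (G := fun _ : G => ℂ) _ (i := x) a

theorem orthogonalFamily_slice (G : Type*) [Group G] :
    OrthogonalFamily ℂ (fun _ : G => Ell2 G ℂ) (fun k => slice k) := by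
  classical
  intro k l hkl ξ η
  -- The coordinates of `slice k ξ` are multiples of `ε_k`.
  have h1 : ∀ x a, inner ℂ (slice k (singleIsometry ℂ x a)) (slice l η) = 0 := by
    intro x a
    have : (innerSL ℂ (slice k (singleIsometry ℂ x a))) ∘L (slice l).toContinuousLinearMap = 0 := by
      refine op_ext fun y b => ?_
      change inner ℂ (slice k (singleIsometry ℂ x a)) (slice l (singleIsometry ℂ y b)) = 0
      rw [slice_single, slice_single, inner_single, singleIsometry_apply]
      split_ifs
      · rw [inner_single, singleIsometry_apply, if_neg hkl, inner_zero_right]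
      · rw [inner_zero_right]
    exact congr($this η)
  have : (innerSL ℂ (slice l η)) ∘L (slice k).toContinuousLinearMap = 0 := by
    refine op_ext fun x a => ?_
    change inner ℂ (slice l η) (slice k (singleIsometry ℂ x a)) = 0
    rw [← inner_conj_symm, h1, map_zero]
  rw [← inner_conj_symm]
  have h2 : inner ℂ (slice l η) (slice k ξ) = 0 := congr($this ξ)
  rw [h2, map_zero]

/-- The isometry (in fact, unitary) of `ℓ²(G, ℓ²(G))`, `ε_x ⊗ ε_k ↦ ε_k ⊗ ε_{x k⁻¹}`. -/
noncomputable def untwist (G : Type*) [Group G] : Ell2 G (Ell2 G ℂ) →ₗᵢ[ℂ] Ell2 G (Ell2 G ℂ) :=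
  (orthogonalFamily_slice G).linearIsometry

theorem untwist_single {G : Type*} [Group G] (k x : G) (a : ℂ) :
    untwist G (singleIsometry _ k (singleIsometry ℂ x a)) =
      singleIsometry _ (x * k⁻¹) (singleIsometry ℂ k a) := by
  classical
  rw [← slice_single]
  have e : (singleIsometry _ k (singleIsometry ℂ x a) : Ell2 G (Ell2 G ℂ)) =
    lp.single (E := fun _ : G => Ell2 G ℂ) 2 k (singleIsometry ℂ x a) := singleIsometry_def k _
  rw [e]
  exact (orthogonalFamily_slice G).linearIsometry_apply_single (i := k) _

/-- The representation `T ↦ Ω (T ⊗ 1) Ω*` of `L(ℓ²(G))` on `ℓ²(G, ℓ²(G))`, where `Ω` is the unitary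
`untwist G`. It maps `λ_g` to the canonical unitary of the crossed product, and a diagonal operator
to its canonical image in the crossed product. -/
noncomputable def ampRep (G : Type*) [Group G] : Op (Ell2 G ℂ) →⋆ₙₐ[ℂ] Op (Ell2 G (Ell2 G ℂ)) :=
  (conjHom (untwist G)).comp (amp G)

theorem ampRep_injective (G : Type*) [Group G] : Injective (ampRep G) :=
  (conjHom_injective _).comp (amp_injective G)

theorem conjHom_apply_apply {H K : Type*} [NormedAddCommGroup H] [InnerProductSpace ℂ H]
    [CompleteSpace H] [NormedAddCommGroup K] [InnerProductSpace ℂ K] [CompleteSpace K]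
    (V : H →ₗᵢ[ℂ] K) (T : Op H) (ξ : H) : conjHom V T (V ξ) = V (T ξ) := by
  change V (T (V.toContinuousLinearMap.adjoint (V ξ))) = _
  rw [adjoint_apply]

theorem ampRep_single {G : Type*} [Group G] (T : Op (Ell2 G ℂ)) (g y : G) (a : ℂ) :
    ampRep G T (singleIsometry _ g (singleIsometry ℂ y a)) =
      untwist G (singleIsometry _ y (T (singleIsometry ℂ (g * y) a))) := by
  have h : (singleIsometry _ g (singleIsometry ℂ y a) : Ell2 G (Ell2 G ℂ)) =
      untwist G (singleIsometry _ y (singleIsometry ℂ (g * y) a)) := by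
    rw [untwist_single, mul_inv_cancel_right]
  rw [h]
  change conjHom (untwist G) (amp G T) _ = _
  rw [conjHom_apply_apply, amp_single]

/-- The left regular representation, as bounded operators. -/
noncomputable def lamOp {G : Type*} [Group G] (g : G) : Op (Ell2 G ℂ) :=
  (lam g).toContinuousLinearMap

theorem lamOp_single {G : Type*} [Group G] (g x : G) (a : ℂ) :
    lamOp g (singleIsometry ℂ x a) = singleIsometry ℂ (g * x) a :=
  shift_single _ (mul_right_injective g) _ _

theorem lamOp_mul {G : Type*} [Group G] (g h : G) : lamOp (g * h) = lamOp g * lamOp h := by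
  refine op_ext fun x a => ?_
  rw [mul_apply_eq_comp, lamOp_single, lamOp_single, lamOp_single, mul_assoc]

theorem lamOp_one {G : Type*} [Group G] : lamOp (1 : G) = 1 := by
  refine op_ext fun x a => ?_
  rw [lamOp_single, one_mul, one_apply_eq_self]

theorem star_lamOp {G : Type*} [Group G] (g : G) : star (lamOp g) = lamOp g⁻¹ := by
  have h : star (lamOp g) * lamOp g = 1 := by
    ext1 ξ
    exact adjoint_apply (lam g) ξ
  calc star (lamOp g) = star (lamOp g) * (lamOp g * lamOp g⁻¹) := by
        rw [← lamOp_mul, mul_inv_cancel, lamOp_one, mul_one]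
    _ = lamOp g⁻¹ := by rw [← mul_assoc, h, one_mul]

theorem conjHom_lam {G : Type*} [Group G] (g : G) (T : Op (Ell2 G ℂ)) :
    conjHom (lam g) T = lamOp g * T * lamOp g⁻¹ := by
  rw [← star_lamOp, mul_assoc]
  rfl

theorem ampRep_lamOp {G : Type*} [Group G] (g : G) :
    ampRep G (lamOp g) = crossedUnitary (Ell2 G ℂ) g := by
  refine op_ext₂ fun h y a => ?_
  rw [ampRep_single, lamOp_single, untwist_single]
  refine Eq.trans ?_ (shift_single (fun x => g * x) (mul_right_injective g) h _).symm
  rw [← mul_assoc, mul_inv_cancel_right]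

/-! ### Diagonal operators -/

theorem proj_commute {X : Type*} (Y Z : Set X) : proj Y * proj Z = proj Z * proj Y := by
  classical
  refine op_ext fun x a => ?_
  rw [mul_apply_eq_comp, mul_apply_eq_comp, proj_single, proj_single]
  by_cases hY : x ∈ Y <;> by_cases hZ : x ∈ Z <;> simp [hY, hZ, proj_single]

theorem star_proj {X : Type*} (Y : Set X) : star (proj Y) = proj Y :=
  isStarProjection_starProjection.isSelfAdjoint

theorem proj_mul_proj {X : Type*} (Y Z : Set X) : proj Y * proj Z = proj (Y ∩ Z) := by
  classical
  refine op_ext fun x a => ?_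
  rw [mul_apply_eq_comp, proj_single, proj_single]
  by_cases hY : x ∈ Y <;> by_cases hZ : x ∈ Z <;> simp [hY, hZ, proj_single]

theorem proj_singleton_apply {X : Type*} (x : X) (ξ : Ell2 X ℂ) :
    proj {x} ξ = singleIsometry ℂ x (ξ x) := by
  classical
  have : proj {x} = (singleIsometry ℂ x).toContinuousLinearMap ∘L
      lp.evalCLM ℂ (fun _ : X => ℂ) 2 x := by
    refine op_ext fun y a => ?_
    change _ = singleIsometry ℂ x ((singleIsometry ℂ y a : Ell2 X ℂ) x)
    rw [proj_single, singleIsometry_apply]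
    by_cases h : y = x
    · subst h; simp
    · simp [h, Ne.symm h]
  exact congr($this ξ)

theorem exists_single_of_commute {X : Type*} {T : Op (Ell2 X ℂ)} (x : X)
    (h : T * proj {x} = proj {x} * T) (a : ℂ) :
    ∃ b, T (singleIsometry ℂ x a) = singleIsometry ℂ x b := by
  classical
  refine ⟨(T (singleIsometry ℂ x a) : Ell2 X ℂ) x, ?_⟩
  have := congr($h (singleIsometry ℂ x a))
  rw [mul_apply_eq_comp, mul_apply_eq_comp, proj_single,
    if_pos (Set.mem_singleton x), proj_singleton_apply] at this
  exact this

/-- The C*-algebra of the operators on `ℓ²(X)` that are diagonal in the standard basis, as the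
commutant of the projections `E_Y`. -/
noncomputable def diagonalOps (X : Type*) : NonUnitalStarSubalgebra ℂ (Op (Ell2 X ℂ)) :=
  NonUnitalStarSubalgebra.centralizer ℂ (Set.range (proj : Set X → _))

theorem isClosed_diagonalOps (X : Type*) : IsClosed (diagonalOps X : Set (Op (Ell2 X ℂ))) := by
  rw [diagonalOps, NonUnitalStarSubalgebra.coe_centralizer]
  exact Set.isClosed_centralizer _

theorem proj_mem_diagonalOps {X : Type*} (Y : Set X) : proj Y ∈ diagonalOps X := by
  rw [diagonalOps, NonUnitalStarSubalgebra.mem_centralizer_iff]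
  rintro _ ⟨Z, rfl⟩
  rw [star_proj]
  exact ⟨proj_commute _ _, proj_commute _ _⟩

theorem dilatedAlgebra_le_diagonalOps {P G : Type*} [Monoid P] [Group G] {i : P →* G}
    (hi : IsEnvelopingGroup i) : dilatedAlgebra hi ≤ diagonalOps G := by
  refine cstarGen_le (isClosed_diagonalOps G) ?_
  intro T hT
  obtain ⟨p, d, hd, rfl⟩ := Set.mem_iUnion.1 hT
  refine map_mem_of_gen (piRep hi p) (continuous_starHom _) (isClosed_diagonalOps G) ?_ hd
  rintro _ ⟨X, -, rfl⟩
  rw [piRep_eq, conj_shift_proj]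
  exact proj_mem_diagonalOps _

variable {P G : Type*} [Monoid P] [IsLeftCancelMul P] [Group G] {i : P →* G}

/-! ### The crossed product as an algebra of operators on `ℓ²(G)` -/

theorem dilatedAction_apply (hi : IsEnvelopingGroup i) (g : G) (d : dilatedAlgebra hi) :
    (dilatedAction hi g d : Op (Ell2 G ℂ)) = lamOp g * (d : Op (Ell2 G ℂ)) * lamOp g⁻¹ :=
  conjHom_lam g d

theorem crossedCoeff_single {A H : Type*} [NonUnitalCStarAlgebra A] [NormedAddCommGroup H]
    [InnerProductSpace ℂ H] [CompleteSpace H] (α : G →* (A ≃⋆ₐ[ℂ] A)) (ρ : A →⋆ₙₐ[ℂ] Op H)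
    (a : A) (g : G) (ξ : H) :
    crossedCoeff α ρ a (singleIsometry H g ξ) = singleIsometry H g (ρ (α g⁻¹ a) ξ) := by
  classical
  ext h : 2
  change ρ (α h⁻¹ a) ((singleIsometry H g ξ : Ell2 G H) h) = _
  rw [singleIsometry_apply, singleIsometry_apply]
  split_ifs with hg
  · rw [hg]
  · rw [map_zero]

theorem crossedCoeff_dilatedAction_single (hi : IsEnvelopingGroup i) (d : dilatedAlgebra hi) (g : G)
    (ξ : Ell2 G ℂ) : crossedCoeff (dilatedAction hi)
      (NonUnitalStarSubalgebraClass.subtype (dilatedAlgebra hi)) d (singleIsometry _ g ξ) =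
        singleIsometry _ g ((lamOp g⁻¹ * (d : Op (Ell2 G ℂ)) * lamOp g) ξ) := by
  rw [crossedCoeff_single, NonUnitalStarSubalgebraClass.subtype_apply, dilatedAction_apply, inv_inv]

theorem ampRep_dilatedAlgebra (hi : IsEnvelopingGroup i) (d : dilatedAlgebra hi) :
    ampRep G (d : Op (Ell2 G ℂ)) = crossedCoeff (dilatedAction hi)
      (NonUnitalStarSubalgebraClass.subtype (dilatedAlgebra hi)) d := by
  refine op_ext₂ fun g y a => ?_
  have hd := dilatedAlgebra_le_diagonalOps hi d.2
  rw [diagonalOps, NonUnitalStarSubalgebra.mem_centralizer_iff] at hd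
  obtain ⟨b, hb⟩ := exists_single_of_commute (g * y) (hd _ ⟨{g * y}, rfl⟩).1.symm a
  rw [ampRep_single, hb, untwist_single, crossedCoeff_dilatedAction_single, mul_inv_cancel_right,
    mul_apply_eq_comp, mul_apply_eq_comp, lamOp_single, hb, lamOp_single, inv_mul_cancel_left]

theorem ampRep_mul_lamOp_mem (hi : IsEnvelopingGroup i) {T : Op (Ell2 G ℂ)}
    (hT : T ∈ dilatedAlgebra hi) (g : G) : ampRep G (T * lamOp g) ∈ dilatedCrossed hi := by
  refine subset_cstarGen _ ⟨⟨T, hT⟩, g, ?_⟩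
  rw [map_mul, ampRep_lamOp, ← ampRep_dilatedAlgebra]

theorem coe_crossedProjP (hi : IsEnvelopingGroup i) :
    (crossedProjP hi : Op (Ell2 G (Ell2 G ℂ))) = ampRep G (proj (Set.range i)) :=
  (ampRep_dilatedAlgebra hi (projP hi)).symm

theorem conj_lamOp_mem (hi : IsEnvelopingGroup i) (g : G) {T : Op (Ell2 G ℂ)}
    (hT : T ∈ dilatedAlgebra hi) : lamOp g * T * lamOp g⁻¹ ∈ dilatedAlgebra hi := by
  rw [← conjHom_lam]
  exact conj_lam_mem hi g hT

theorem lamOp_mul_inv_cancel (g : G) : lamOp g * lamOp g⁻¹ = 1 := by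
  rw [← lamOp_mul, mul_inv_cancel, lamOp_one]

theorem lamOp_inv_mul_cancel (g : G) : lamOp g⁻¹ * lamOp g = 1 := by
  rw [← lamOp_mul, inv_mul_cancel, lamOp_one]

/-- A closed subspace contains the crossed product as soon as it contains the operators `π_p(d)
λ_g`. -/
theorem dilatedCrossed_le_closed_submodule (hi : IsEnvelopingGroup i)
    {M : Submodule ℂ (Op (Ell2 G (Ell2 G ℂ)))} (hM : IsClosed (M : Set (Op (Ell2 G (Ell2 G ℂ)))))
    (h : ∀ (p : P) (d : diagonalAlgebra P) (g : G), ampRep G (piRep hi p d * lamOp g) ∈ M) :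
    (dilatedCrossed hi : Set (Op (Ell2 G (Ell2 G ℂ)))) ⊆ M := by
  have hrep : ∀ (d : dilatedAlgebra hi) (g : G),
      crossedCoeff (dilatedAction hi) (NonUnitalStarSubalgebraClass.subtype (dilatedAlgebra hi)) d *
        crossedUnitary (Ell2 G ℂ) g = ampRep G (d * lamOp g) := fun d g => by
    rw [map_mul, ampRep_lamOp, ampRep_dilatedAlgebra]
  refine cstarGen_le_closed_submodule ?_ ?_ hM ?_
  · rintro _ ⟨a, g, rfl⟩ _ ⟨b, h, rfl⟩
    refine ⟨a * ⟨_, conj_lamOp_mem hi g b.2⟩, g * h, ?_⟩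
    rw [hrep, hrep, hrep, ← map_mul, lamOp_mul]
    congr 1
    change (a : Op (Ell2 G ℂ)) * lamOp g * ((b : Op (Ell2 G ℂ)) * lamOp h) =
      (a : Op (Ell2 G ℂ)) * (lamOp g * (b : Op (Ell2 G ℂ)) * lamOp g⁻¹) * (lamOp g * lamOp h)
    simp only [mul_assoc]
    rw [← mul_assoc (lamOp g⁻¹), lamOp_inv_mul_cancel, one_mul]
  · rintro _ ⟨a, g, rfl⟩
    refine ⟨⟨_, conj_lamOp_mem hi g⁻¹ (star a).2⟩, g⁻¹, ?_⟩
    rw [hrep, hrep, ← map_star, star_mul, star_lamOp]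
    congr 1
    simp only [mul_assoc]
    rw [inv_inv, lamOp_mul_inv_cancel, mul_one]
    rfl
  · rintro _ ⟨a, g, rfl⟩
    rw [hrep]
    have hc : Continuous fun a : dilatedAlgebra hi => ampRep G ((a : Op (Ell2 G ℂ)) * lamOp g) :=
      (continuous_starHom (ampRep G)).comp (continuous_subtype_val.mul continuous_const)
    have hcl : IsClosed {a : dilatedAlgebra hi | ampRep G ((a : Op (Ell2 G ℂ)) * lamOp g) ∈ M} :=
      hM.preimage hc
    refine closure_minimal ?_ hcl (dense_iUnion_range_limitIncl hi a)
    intro b hb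
    obtain ⟨p, d, rfl⟩ := Set.mem_iUnion.1 hb
    exact h p d g

/-! ### Compression to `ℓ²(P)` -/

/-- The embedding `ℓ²(P) → ℓ²(G)` as a bounded operator. -/
noncomputable def embedOp {P : Type*} [Monoid P] {i : P →* G} (hi : IsEnvelopingGroup i) :
    Ell2 P ℂ →L[ℂ] Ell2 G ℂ :=
  (embed hi).toContinuousLinearMap

theorem conjHom_embed {P : Type*} [Monoid P] {i : P →* G}
    (hi : IsEnvelopingGroup i) (T : Op (Ell2 P ℂ)) :
    conjHom (embed hi) T = embedOp hi ∘L T ∘L (embedOp hi).adjoint := rfl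

theorem proj_univ (X : Type*) : proj (Set.univ : Set X) = 1 := by
  classical
  refine op_ext fun x a => ?_
  rw [proj_single, if_pos (Set.mem_univ x), one_apply_eq_self]

theorem conjHom_embed_one {P : Type*} [Monoid P] {i : P →* G}
    (hi : IsEnvelopingGroup i) :
    conjHom (embed hi) 1 = proj (Set.range i) := by
  rw [← proj_univ, embed, conj_shift_proj, Set.image_univ]

theorem proj_mul_conjHom_embed {P : Type*} [Monoid P] {i : P →* G}
    (hi : IsEnvelopingGroup i) (T : Op (Ell2 P ℂ)) :
    proj (Set.range i) * conjHom (embed hi) T = conjHom (embed hi) T := by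
  rw [← conjHom_embed_one hi, ← map_mul, one_mul]

theorem conjHom_embed_mul_proj {P : Type*} [Monoid P] {i : P →* G}
    (hi : IsEnvelopingGroup i) (T : Op (Ell2 P ℂ)) :
    conjHom (embed hi) T * proj (Set.range i) = conjHom (embed hi) T := by
  rw [← conjHom_embed_one hi, ← map_mul, mul_one]

theorem proj_idem {X : Type*} (Y : Set X) : proj Y * proj Y = proj Y := by
  rw [proj_mul_proj, Set.inter_self]

theorem V_single (p x : P) (a : ℂ) :
    V p (singleIsometry ℂ x a) = singleIsometry ℂ (p * x) a :=
  shift_single _ (mul_right_injective p) _ _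

/-- `E_P λ_p E_P = V_p`, and `λ_p` maps `ℓ²(P)` into itself. -/
theorem conjHom_embed_V (hi : IsEnvelopingGroup i) (p : P) :
    conjHom (embed hi) (V p) = lamOp (i p) * proj (Set.range i) := by
  rw [← conjHom_embed_one hi, conjHom_embed, conjHom_embed]
  have h : embedOp hi ∘L V p = lamOp (i p) ∘L embedOp hi := by
    refine op_ext fun x a => ?_
    have he : ∀ y b, embedOp hi (singleIsometry ℂ y b) = singleIsometry ℂ (i y) b := fun y b =>
      shift_single _ hi.injective _ _
    rw [ContinuousLinearMap.comp_apply, ContinuousLinearMap.comp_apply, V_single, he, he,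
      lamOp_single, map_mul]
  rw [← ContinuousLinearMap.comp_assoc, h]
  rfl

theorem conjHom_embed_star_V (hi : IsEnvelopingGroup i) (p : P) :
    conjHom (embed hi) (star (V p)) = proj (Set.range i) * lamOp (i p)⁻¹ := by
  rw [map_star, conjHom_embed_V, star_mul, star_proj, star_lamOp]

theorem piRep_eq_lamOp {P : Type*} [Monoid P] {i : P →* G}
    (hi : IsEnvelopingGroup i) (p : P) (T : Op (Ell2 P ℂ)) :
    piRep hi p T = lamOp (i p)⁻¹ * conjHom (embed hi) T * lamOp (i p) := by
  change conjHom (lam (i p)⁻¹) (conjHom (embed hi) T) = _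
  rw [conjHom_lam, inv_inv]

theorem V_one : V (1 : P) = 1 := by
  refine op_ext fun x a => ?_
  rw [V_single, one_mul, one_apply_eq_self]

theorem V_mem (p : P) : V p ∈ CStarReduced P := subset_cstarGen _ ⟨p, rfl⟩

theorem star_V_mul_proj_mul_V (p : P) (X : Set P) :
    star (V p) * proj X * V p = proj ((fun x => p * x) ⁻¹' X) := by
  classical
  refine op_ext fun x a => ?_
  rw [mul_apply_eq_comp, mul_apply_eq_comp, V_single, proj_single, proj_single]
  by_cases h : p * x ∈ X
  · rw [if_pos h, if_pos (show x ∈ (fun x => p * x) ⁻¹' X from h), ← V_single]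
    exact adjoint_apply (leftIsometry p) _
  · rw [if_neg h, if_neg (show x ∉ (fun x => p * x) ⁻¹' X from h), map_zero]

theorem diagonalAlgebra_le_CStarReduced : diagonalAlgebra P ≤ CStarReduced P := by
  refine cstarGen_le (NonUnitalStarSubalgebra.isClosed_topologicalClosure _) ?_
  rintro _ ⟨X, hX, rfl⟩
  induction hX with
  | empty =>
    have : proj (∅ : Set P) = 0 := by
      classical
      refine op_ext fun x a => ?_
      rw [proj_single, if_neg (Set.notMem_empty x), zero_apply]
    rw [this]
    exact zero_mem (CStarReduced P)
  | univ =>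
    rw [proj_univ, ← V_one]
    exact V_mem 1
  | image p _ ih =>
    rw [← conj_shift_proj _ (mul_right_injective p)]
    exact mul_mem (S := NonUnitalStarSubalgebra ℂ (Op (Ell2 P ℂ))) (V_mem p)
      (mul_mem (S := NonUnitalStarSubalgebra ℂ (Op (Ell2 P ℂ))) ih (star_mem (V_mem p)))
  | preimage p _ ih =>
    rw [← star_V_mul_proj_mul_V]
    exact mul_mem (S := NonUnitalStarSubalgebra ℂ (Op (Ell2 P ℂ)))
      (mul_mem (S := NonUnitalStarSubalgebra ℂ (Op (Ell2 P ℂ))) (star_mem (V_mem p)) ih) (V_mem p)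
  | inter _ _ ihX ihY =>
    rw [← proj_mul_proj]
    exact mul_mem (S := NonUnitalStarSubalgebra ℂ (Op (Ell2 P ℂ))) ihX ihY

/-- The representation of the operators on `ℓ²(P)` on `ℓ²(G, ℓ²(G))` that restricts to the inclusion
of `C*_r(P)` into the crossed product. -/
noncomputable def cornerRep {P : Type*} [Monoid P] {i : P →* G} (hi : IsEnvelopingGroup i) :
    Op (Ell2 P ℂ) →⋆ₙₐ[ℂ] Op (Ell2 G (Ell2 G ℂ)) :=
  (ampRep G).comp (conjHom (embed hi))

theorem cornerRep_apply {P : Type*} [Monoid P] {i : P →* G}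
    (hi : IsEnvelopingGroup i) (T : Op (Ell2 P ℂ)) :
    cornerRep hi T = ampRep G (conjHom (embed hi) T) := rfl

theorem cornerRep_injective {P : Type*} [Monoid P] {i : P →* G}
    (hi : IsEnvelopingGroup i) : Injective (cornerRep hi) :=
  (ampRep_injective G).comp (conjHom_injective _)

theorem cornerRep_V (hi : IsEnvelopingGroup i) (p : P) :
    cornerRep hi (V p) = (crossedProjP hi : Op (Ell2 G (Ell2 G ℂ))) *
      crossedUnitary (Ell2 G ℂ) (i p) * (crossedProjP hi : Op (Ell2 G (Ell2 G ℂ))) := by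
  rw [coe_crossedProjP, ← ampRep_lamOp, ← map_mul, ← map_mul, mul_assoc, ← conjHom_embed_V,
    proj_mul_conjHom_embed]
  rfl

theorem cornerRep_mem (hi : IsEnvelopingGroup i) {T : Op (Ell2 P ℂ)} (hT : T ∈ CStarReduced P) :
    cornerRep hi T ∈ dilatedCrossed hi := by
  refine map_mem_of_gen (cornerRep hi) (continuous_starHom _)
    (NonUnitalStarSubalgebra.isClosed_topologicalClosure _) ?_ hT
  rintro _ ⟨p, rfl⟩
  rw [cornerRep_V]
  refine mul_mem (S := NonUnitalStarSubalgebra ℂ (Op (Ell2 G (Ell2 G ℂ)))) ?_ (crossedProjP hi).2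
  exact subset_cstarGen _ ⟨projP hi, i p, rfl⟩

/-- The inclusion `C*_r(P) → D_r^{(∞)}(P) ⋊_r G`, `V_p ↦ E_P U_p E_P`. -/
noncomputable def cornerIncl (hi : IsEnvelopingGroup i) :
    CStarReduced P →⋆ₙₐ[ℂ] dilatedCrossed hi :=
  NonUnitalStarAlgHom.codRestrict
    ((cornerRep hi).comp (NonUnitalStarSubalgebraClass.subtype (CStarReduced P)))
    _ fun T => cornerRep_mem hi T.2

theorem cornerIncl_injective (hi : IsEnvelopingGroup i) : Injective (cornerIncl hi) := fun _ _ h =>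
  Subtype.ext (cornerRep_injective hi (congrArg Subtype.val h))

/-- The compression of `π_p(d) λ_g` to `ℓ²(P)` is `V_p* d V_a* V_b`, where `p g = a⁻¹ b`. -/
theorem compression_eq (hi : IsEnvelopingGroup i) {p a b : P} {g : G}
    (h : i p * g = (i a)⁻¹ * i b) (T : Op (Ell2 P ℂ)) :
    proj (Set.range i) * (piRep hi p T * lamOp g) * proj (Set.range i) =
      conjHom (embed hi) (star (V p) * T * star (V a) * V b) := by
  set E := proj (Set.range i) with hE
  set T' := conjHom (embed hi) T with hT'
  have h1 : T' * E = T' := conjHom_embed_mul_proj hi T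
  calc E * (piRep hi p T * lamOp g) * E
      = E * lamOp (i p)⁻¹ * T' * (lamOp (i p) * lamOp g) * E := by
        rw [piRep_eq_lamOp]
        simp only [mul_assoc, hT']
    _ = E * lamOp (i p)⁻¹ * (T' * E) * (lamOp (i a)⁻¹ * lamOp (i b)) * E := by
        rw [← lamOp_mul, h, lamOp_mul, h1]
    _ = (E * lamOp (i p)⁻¹) * T' * (E * lamOp (i a)⁻¹) * (lamOp (i b) * E) := by
        simp only [mul_assoc]
    _ = _ := by
        rw [hE, ← conjHom_embed_star_V hi, ← conjHom_embed_star_V hi, ← conjHom_embed_V hi, hT',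
          ← map_mul, ← map_mul, ← map_mul]

/-- The space of the operators on `ℓ²(G, ℓ²(G))` whose compression by `E_P` lies in `C*_r(P)`. -/
noncomputable def compressionPreimage (hi : IsEnvelopingGroup i) :
    Submodule ℂ (Op (Ell2 G (Ell2 G ℂ))) :=
  ((CStarReduced P).toNonUnitalSubalgebra.toSubmodule.map
    (cornerRep hi : Op (Ell2 P ℂ) →ₗ[ℂ] Op (Ell2 G (Ell2 G ℂ)))).comap
      ((LinearMap.mulRight ℂ (crossedProjP hi : Op (Ell2 G (Ell2 G ℂ)))).comp
        (LinearMap.mulLeft ℂ (crossedProjP hi : Op (Ell2 G (Ell2 G ℂ)))))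

theorem mem_compressionPreimage (hi : IsEnvelopingGroup i) {T : Op (Ell2 G (Ell2 G ℂ))} :
    T ∈ compressionPreimage hi ↔ ∃ S ∈ CStarReduced P, cornerRep hi S =
      (crossedProjP hi : Op (Ell2 G (Ell2 G ℂ))) * T *
        (crossedProjP hi : Op (Ell2 G (Ell2 G ℂ))) := Iff.rfl

theorem isClosed_compressionPreimage (hi : IsEnvelopingGroup i) :
    IsClosed (compressionPreimage hi : Set (Op (Ell2 G (Ell2 G ℂ)))) := by
  have hN : IsClosed (cornerRep hi '' (CStarReduced P : Set (Op (Ell2 P ℂ)))) :=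
    (NonUnitalStarAlgHom.isometry (cornerRep hi)
      (cornerRep_injective hi)).isClosedEmbedding.isClosedMap _
        (NonUnitalStarSubalgebra.isClosed_topologicalClosure _)
  exact hN.preimage ((continuous_const.mul continuous_id).mul continuous_const)

theorem range_cornerIncl (hi : IsEnvelopingGroup i) :
    Set.range (cornerIncl hi) = corner (crossedProjP hi) := by
  apply Set.Subset.antisymm
  · rintro _ ⟨T, rfl⟩
    refine ⟨cornerIncl hi T, Subtype.ext ?_⟩
    change cornerRep hi T = (crossedProjP hi : Op (Ell2 G (Ell2 G ℂ))) * cornerRep hi T *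
      (crossedProjP hi : Op (Ell2 G (Ell2 G ℂ)))
    rw [coe_crossedProjP, cornerRep_apply, ← map_mul, ← map_mul, proj_mul_conjHom_embed,
      conjHom_embed_mul_proj]
  · rintro _ ⟨b, rfl⟩
    have hbM : (b : Op (Ell2 G (Ell2 G ℂ))) ∈ compressionPreimage hi := by
      refine dilatedCrossed_le_closed_submodule hi (isClosed_compressionPreimage hi)
        (fun p d g => ?_) b.2
      obtain ⟨x, y, hxy⟩ := hi.exists_quotient (i p * g)
      refine (mem_compressionPreimage hi).2 ⟨star (V p) * d * star (V x) * V y, ?_, ?_⟩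
      · exact mul_mem (S := NonUnitalStarSubalgebra ℂ (Op (Ell2 P ℂ)))
          (mul_mem (S := NonUnitalStarSubalgebra ℂ (Op (Ell2 P ℂ)))
          (mul_mem (S := NonUnitalStarSubalgebra ℂ (Op (Ell2 P ℂ))) (star_mem (V_mem p))
            (diagonalAlgebra_le_CStarReduced d.2)) (star_mem (V_mem x))) (V_mem y)
      · rw [cornerRep_apply, ← compression_eq hi hxy, map_mul, map_mul, coe_crossedProjP]
    have hex : ∃ S ∈ CStarReduced P, cornerRep hi S =
        ((crossedProjP hi * b * crossedProjP hi : dilatedCrossed hi) :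
          Op (Ell2 G (Ell2 G ℂ))) := (mem_compressionPreimage hi).1 hbM
    exact hex.elim fun T hT => ⟨⟨T, hT.1⟩, Subtype.ext hT.2⟩

/-! ### Fullness of the projection -/

theorem isFullProjection_crossedProjP (hi : IsEnvelopingGroup i) :
    IsFullProjection (crossedProjP hi) := by
  refine ⟨⟨Subtype.ext ?_, Subtype.ext ?_⟩, ?_⟩
  · change (crossedProjP hi : Op (Ell2 G (Ell2 G ℂ))) * (crossedProjP hi : Op (Ell2 G (Ell2 G ℂ))) =
      crossedProjP hi
    rw [coe_crossedProjP, ← map_mul, proj_idem]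
  · change star (crossedProjP hi : Op (Ell2 G (Ell2 G ℂ))) = crossedProjP hi
    rw [coe_crossedProjP, ← map_star, star_proj]
  · let S := Submodule.span ℂ {x : dilatedCrossed hi | ∃ b c, x = b * crossedProjP hi * c}
    let N : Submodule ℂ (Op (Ell2 G (Ell2 G ℂ))) :=
      S.map (dilatedCrossed hi).toNonUnitalSubalgebra.toSubmodule.subtype
    have key : (dilatedCrossed hi : Set (Op (Ell2 G (Ell2 G ℂ)))) ⊆ N.topologicalClosure := by
      refine dilatedCrossed_le_closed_submodule hi N.isClosed_topologicalClosure fun p d g =>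
        N.le_topologicalClosure ?_
      set E := proj (Set.range i) with hE
      have hEmem : E ∈ dilatedAlgebra hi := (projP hi).2
      -- `π_p(d) λ_g = (λ_p* E) E (d λ_{pg})`, and `λ_p* E = (λ_p* E λ_p) λ_p*`.
      let b : dilatedCrossed hi :=
        ⟨_, ampRep_mul_lamOp_mem hi (conj_lamOp_mem hi (i p)⁻¹ hEmem) (i p)⁻¹⟩
      have hd : conjHom (embed hi) d ∈ dilatedAlgebra hi := by
        have h : piRep hi 1 d ∈ dilatedAlgebra hi := (limitIncl hi 1 d).2
        rwa [piRep_eq_lamOp, map_one, inv_one, lamOp_one, one_mul, mul_one] at h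
      let c : dilatedCrossed hi := ⟨_, ampRep_mul_lamOp_mem hi hd (i p * g)⟩
      refine ⟨b * crossedProjP hi * c, Submodule.subset_span ⟨b, c, rfl⟩, ?_⟩
      change ampRep G _ * (crossedProjP hi : Op (Ell2 G (Ell2 G ℂ))) * ampRep G _ = ampRep G _
      rw [coe_crossedProjP, ← map_mul, ← map_mul, piRep_eq_lamOp, lamOp_mul, inv_inv]
      congr 1
      have h1 : lamOp (i p)⁻¹ * E * lamOp (i p) * lamOp (i p)⁻¹ = lamOp (i p)⁻¹ * E := by
        rw [mul_assoc, lamOp_mul_inv_cancel, mul_one]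
      have h2 : E * (E * conjHom (embed hi) d) = conjHom (embed hi) d := by
        rw [proj_mul_conjHom_embed, proj_mul_conjHom_embed]
      rw [h1, ← hE]
      calc lamOp (i p)⁻¹ * E * E * (conjHom (embed hi) d * (lamOp (i p) * lamOp g))
          = lamOp (i p)⁻¹ * (E * (E * conjHom (embed hi) d)) * lamOp (i p) * lamOp g := by
            simp only [mul_assoc]
        _ = _ := by rw [h2]
    intro x
    rw [closure_subtype]
    exact key x.2

/-! ### Separability -/

/-- A countable family of sets is closed under countably many unary operations and one binary one in
only countably many steps. -/
theorem countable_constructible (P : Type*) [Monoid P] [Countable P] :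
    {X : Set P | IsConstructible X}.Countable := by
  let step : Set (Set P) → Set (Set P) := fun F =>
    F ∪ (⋃ p : P, Set.image (fun x => p * x) '' F) ∪ (⋃ p : P, Set.preimage (fun x => p * x) '' F) ∪
      Set.image2 (· ∩ ·) F F
  have hstep : ∀ F : Set (Set P), F.Countable → (step F).Countable := fun F hF =>
    ((hF.union (Set.countable_iUnion fun p => hF.image _)).union
      (Set.countable_iUnion fun p => hF.image _)).union (hF.image2 hF _)
  let F : ℕ → Set (Set P) := fun n => step^[n] {∅, Set.univ}
  have hsucc : ∀ n, F (n + 1) = step (F n) := fun n => iterate_succ_apply' _ _ _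
  have hF : ∀ n, (F n).Countable := by
    intro n
    induction n with
    | zero => exact (Set.countable_singleton _).insert _
    | succ n ih => rw [hsucc]; exact hstep _ ih
  have hmono : Monotone F := monotone_nat_of_le_succ fun n X hX => by
    rw [hsucc]
    exact Or.inl (Or.inl (Or.inl hX))
  refine (Set.countable_iUnion hF).mono fun X hX => ?_
  induction hX with
  | empty => exact Set.mem_iUnion.2 ⟨0, Or.inl rfl⟩
  | univ => exact Set.mem_iUnion.2 ⟨0, Or.inr rfl⟩
  | image p _ ih =>
    obtain ⟨n, hn⟩ := Set.mem_iUnion.1 ih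
    refine Set.mem_iUnion.2 ⟨n + 1, ?_⟩
    rw [hsucc]
    exact Or.inl (Or.inl (Or.inr (Set.mem_iUnion.2 ⟨p, _, hn, rfl⟩)))
  | preimage p _ ih =>
    obtain ⟨n, hn⟩ := Set.mem_iUnion.1 ih
    refine Set.mem_iUnion.2 ⟨n + 1, ?_⟩
    rw [hsucc]
    exact Or.inl (Or.inr (Set.mem_iUnion.2 ⟨p, _, hn, rfl⟩))
  | inter _ _ ihX ihY =>
    obtain ⟨m, hm⟩ := Set.mem_iUnion.1 ihX
    obtain ⟨n, hn⟩ := Set.mem_iUnion.1 ihY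
    refine Set.mem_iUnion.2 ⟨max m n + 1, ?_⟩
    rw [hsucc]
    exact Or.inr ⟨_, hmono (le_max_left m n) hm, _, hmono (le_max_right m n) hn, rfl⟩

theorem separableSpace_CStarReduced [Countable P] :
    TopologicalSpace.SeparableSpace (CStarReduced P) :=
  (isSeparable_cstarGen (Set.countable_range _).isSeparable).separableSpace

theorem IsEnvelopingGroup.countable {P : Type*} [Monoid P] {i : P →* G} [Countable P]
    (hi : IsEnvelopingGroup i) : Countable G := by
  have : Surjective fun x : P × P => (i x.1)⁻¹ * i x.2 := fun g => by
    obtain ⟨q, p, h⟩ := hi.exists_quotient g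
    exact ⟨(q, p), h.symm⟩
  exact this.countable

theorem separableSpace_dilatedCrossed [Countable P] (hi : IsEnvelopingGroup i) :
    TopologicalSpace.SeparableSpace (dilatedCrossed hi) := by
  have := hi.countable
  have hD : TopologicalSpace.IsSeparable (diagonalAlgebra P : Set (Op (Ell2 P ℂ))) := by
    refine isSeparable_cstarGen (Set.Countable.isSeparable ?_)
    refine ((countable_constructible P).image proj).mono ?_
    rintro _ ⟨X, hX, rfl⟩
    exact ⟨X, hX, rfl⟩
  have hD' : TopologicalSpace.IsSeparable (dilatedAlgebra hi : Set (Op (Ell2 G ℂ))) :=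
    isSeparable_cstarGen (TopologicalSpace.IsSeparable.iUnion fun p =>
      hD.image (continuous_starHom (piRep hi p)))
  refine (isSeparable_cstarGen ?_ : TopologicalSpace.IsSeparable
    (dilatedCrossed hi : Set (Op (Ell2 G (Ell2 G ℂ))))).separableSpace
  have hc : ∀ g : G, Continuous fun T : Op (Ell2 G ℂ) => ampRep G (T * lamOp g) := fun g =>
    (continuous_starHom (ampRep G)).comp (continuous_id.mul continuous_const)
  refine (TopologicalSpace.IsSeparable.iUnion fun g : G => hD'.image (hc g)).mono ?_
  rintro _ ⟨a, g, rfl⟩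
  refine Set.mem_iUnion.2 ⟨g, a, a.2, ?_⟩
  change ampRep G (_ * _) = _
  rw [map_mul, ampRep_lamOp, ampRep_dilatedAlgebra]

end OreDilation

open OreDilation
theorem mainTheorem10 {P G : Type u} [Monoid P] [IsLeftOre P] [Group G] {i : P →* G}
    (hi : IsEnvelopingGroup i) :
    IsFullProjection (crossedProjP hi) ∧
    ∃ ι : CStarReduced P →⋆ₙₐ[ℂ] dilatedCrossed hi,
      (∀ p : P, (ι (genV p) : Op (Ell2 G (Ell2 G ℂ))) =
        (crossedProjP hi : Op (Ell2 G (Ell2 G ℂ))) * crossedUnitary (Ell2 G ℂ) (i p) *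
          (crossedProjP hi : Op (Ell2 G (Ell2 G ℂ)))) ∧
      Function.Injective ι ∧
      Set.range ι = corner (crossedProjP hi) ∧
      (Countable P →
        ∃ (_ : TopologicalSpace.SeparableSpace (CStarReduced P))
          (_ : TopologicalSpace.SeparableSpace (dilatedCrossed hi)),
          KK.IsEquivalence (KK.ofHom ι)) := by
  have hfull := isFullProjection_crossedProjP hi
  refine ⟨hfull, cornerIncl hi, cornerRep_V hi, cornerIncl_injective hi, range_cornerIncl hi,
    fun _ => ⟨separableSpace_CStarReduced, separableSpace_dilatedCrossed hi, ?_⟩⟩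
  have := separableSpace_CStarReduced (P := P)
  have := separableSpace_dilatedCrossed hi
  exact CornerIso.isEquivalence (c := ⟨cornerIncl hi, crossedProjP hi, hfull.isStarProjection,
    cornerIncl_injective hi, range_cornerIncl hi⟩) hfull
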